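/- Let $K\subset\mathbb R^2$ be a nonempty compact convex set with support function $p(\varphi)=\sup\{\langle x,N(\varphi)\rangle : x\in K\}$, $N(\varphi)=(\cos\varphi,\sin\varphi)$. Assume that $K$ is strictly convex with boundary $\Gamma=\partial K$ of class $C^2$, in the sense that $p$ is of class $C^2$ and the radius of curvature $p(\varphi)+p''(\varphi)$ is positive for every $\varphi$. Let $L$ be the length of $\Gamma$, $F$ the area of $K$ and $\Delta=L^2-4\pi F$ the isoperimetric deficit. For a $2\pi$-periodic $C^1$ function $f$, the area with multiplicities of the envelope of the lines $x\cos t+y\sin t=f(t)$, $0\le t\le 2\pi$, is $\frac12\int_0^{2\pi}(f^2-f'^2)\,dt$ (which equals $\frac12\int_0^{2\pi} f(f+f'')\,dt$ when $f$ is $C^2$). Let $F_e$ be the area with multiplicities enclosed by the evolute of $\Gamma$, the envelope of the normal lines of $\Gamma$, for which $f(t)=\langle\gamma(t-\pi/2),N(t)\rangle=p'(t-\pi/2)$, where $\gamma(\varphi)=p(\varphi)N(\varphi)+p'(\varphi)N'(\varphi)$ parametrizes $\Gamma$. For $P\notin K$ let $\omega=\omega(P)$ be the visual angle of $\Gamma$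 from $P$, that is, the angle $\angle APB$, where $A,B\in\Gamma$ are the points of contact of the two tangents from $P$ to $\Gamma$, and let $dP$ be the area measure. Then $\omega-\sin\omega-\frac23\sin^3\omega$ is integrable over $\mathbb R^2\setminus K$ and $$\pi|F_e|-\Delta\ \ge\ \frac54L^2+5\int_{P\notin K}\Bigl(\omega-\sin\omega-\frac23\sin^3\omega\Bigr)\,dP .$$ Moreover, the right-hand side is strictly positive if $\pi|F_e|-\Delta\neq0$, and it is equal to $0$ if $\pi|F_e|-\Delta=0$. -/

import Mathlib

open Real MeasureTheory

noncomputable section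

namespace Hurwitz

/-- The Euclidean plane. -/
abbrev Plane : Type := EuclideanSpace ℝ (Fin 2)

/-- The unit vector `N(φ) = (cos φ, sin φ)`. -/
def N (φ : ℝ) : Plane := !₂[Real.cos φ, Real.sin φ]

/-- The derivative `N'(φ) = (-sin φ, cos φ)` of `N`. -/
def N' (φ : ℝ) : Plane := !₂[-Real.sin φ, Real.cos φ]

/-- The support function `p(φ) = sup {⟨x, N(φ)⟩ : x ∈ K}` of `K`. -/
def supportFn (K : Set Plane) (φ : ℝ) : ℝ :=
  sSup ((fun x : Plane => inner ℝ x (N φ)) '' K)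

/-- A nonempty compact convex set whose support function is of class `C²` with everywhere
positive radius of curvature `p + p''`. The boundary of such a set is a simple closed curve of
class `C²` with positive curvature. -/
structure IsStrictlyConvexC2 (K : Set Plane) : Prop where
  nonempty : K.Nonempty
  isCompact : IsCompact K
  convex : Convex ℝ K
  contDiff : ContDiff ℝ 2 (supportFn K)
  radius_pos : ∀ φ : ℝ, 0 < supportFn K φ + deriv (deriv (supportFn K)) φ

/-- The length of the boundary `Γ = ∂K` (one-dimensional Hausdorff measure). -/
def length (K : Set Plane) : ℝ := (Measure.hausdorffMeasure 1 (frontier K)).toReal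

/-- The area of `K`. -/
def area (K : Set Plane) : ℝ := (volume K).toReal

/-- The isoperimetric deficit `Δ = L² - 4πF`. -/
def isoDeficit (K : Set Plane) : ℝ := length K ^ 2 - 4 * π * area K

/-- The point `γ(φ) = p(φ) N(φ) + p'(φ) N'(φ)` of `Γ` with outer normal vector `N(φ)`. -/
def boundaryPt (K : Set Plane) (φ : ℝ) : Plane :=
  supportFn K φ • N φ + deriv (supportFn K) φ • N' φ

/-- The area with multiplicities of the closed curve with `2π`-periodic generalized support
function `f`, that is, of the envelope of the lines `x cos t + y sin t = f t`, `0 ≤ t ≤ 2π`. For `f`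
of class `C²` it is `(1/2) ∫ f (f + f'')`, the area swept by the radius vector of the curve
(see `multArea_eq`); the form used here also makes sense for `f` of class `C¹`. -/
def multArea (f : ℝ → ℝ) : ℝ := (1 / 2) * ∫ t in (0 : ℝ)..(2 * π), (f t ^ 2 - deriv f t ^ 2)

theorem multArea_eq (f : ℝ → ℝ) (hf : ContDiff ℝ 2 f) (hper : Function.Periodic f (2 * π)) :
    multArea f = (1 / 2) * ∫ t in (0 : ℝ)..(2 * π), f t * (f t + deriv (deriv f) t) := by
  have hf1 : ContDiff ℝ 1 (deriv f) := by
    have h : ContDiff ℝ (1 + 1) f := by simpa [one_add_one_eq_two] using hf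
    exact (contDiff_succ_iff_deriv.1 h).2.2
  have hd : Differentiable ℝ f := hf.differentiable (by norm_num)
  have hd1 : Differentiable ℝ (deriv f) := hf1.differentiable (by norm_num)
  have hc0 : Continuous f := hd.continuous
  have hc1 : Continuous (deriv f) := hd1.continuous
  have hc2 : Continuous (deriv (deriv f)) := hf1.continuous_deriv le_rfl
  have hper' : deriv f (2 * π) = deriv f 0 := by
    have h := deriv_comp_add_const f (2 * π) 0
    have h2 : (fun x => f (x + 2 * π)) = f := funext hper
    rw [h2] at h
    simpa using h.symm
  have hp0 : f (2 * π) = f 0 := by simpa using hper 0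
  have key : ∫ t in (0 : ℝ)..(2 * π), (deriv f t * deriv f t + f t * deriv (deriv f) t) = 0 := by
    rw [intervalIntegral.integral_deriv_mul_eq_sub (fun x _ => (hd x).hasDerivAt)
      (fun x _ => (hd1 x).hasDerivAt) (hc1.intervalIntegrable _ _) (hc2.intervalIntegrable _ _),
      hp0, hper', sub_self]
  have hadd := intervalIntegral.integral_add (μ := volume) (a := 0) (b := 2 * π)
    (f := fun t => f t ^ 2 - deriv f t ^ 2)
    (g := fun t => deriv f t * deriv f t + f t * deriv (deriv f) t)
    (Continuous.intervalIntegrable (by fun_prop) _ _)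
    (Continuous.intervalIntegrable (by fun_prop) _ _)
  rw [key, add_zero] at hadd
  unfold multArea
  rw [← hadd]
  congr 2
  ext t
  ring

/-- The generalized support function of the evolute of `Γ`. The evolute is the envelope of the
normal lines of `Γ`; the normal line at `γ(t - π/2)` is orthogonal to `N'(t - π/2) = N(t)`, so it is
the line `⟨x, N(t)⟩ = ⟨γ(t - π/2), N(t)⟩`. -/
def evoluteSupport (K : Set Plane) (t : ℝ) : ℝ := inner ℝ (boundaryPt K (t - π / 2)) (N t)

theorem evoluteSupport_eq (K : Set Plane) (t : ℝ) :
    evoluteSupport K t = deriv (supportFn K) (t - π / 2) := by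
  have h := Real.sin_sq_add_cos_sq t
  simp only [evoluteSupport, boundaryPt, N, N', PiLp.inner_apply, Fin.sum_univ_two,
    PiLp.add_apply, PiLp.smul_apply, Real.cos_sub_pi_div_two, Real.sin_sub_pi_div_two]
  simp
  linear_combination (deriv (supportFn K) (t - π / 2)) * h

/-- The (algebraic) area with multiplicities `F_e` enclosed by the evolute of `Γ`. -/
def evoluteArea (K : Set Plane) : ℝ := multArea (evoluteSupport K)

/-- The Hurwitz deficit `π |F_e| - Δ`. -/
def hurwitzDeficit (K : Set Plane) : ℝ := π * |evoluteArea K| - isoDeficit K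

/-- The points of contact `A ∈ Γ` of the support (tangent) lines of `K` that pass through `P`. -/
def tangentPts (K : Set Plane) (P : Plane) : Set Plane :=
  {A | A ∈ frontier K ∧
    ∃ φ : ℝ, inner ℝ A (N φ) = supportFn K φ ∧ inner ℝ P (N φ) = supportFn K φ}

/-- The visual angle of `Γ` from `P ∉ K`: the angle `∠ A P B`, where `A` and `B` are the two points
of contact of the tangents from `P` to `Γ` (pairs with `A = B` only contribute the angle `0`). -/
def visualAngle (K : Set Plane) (P : Plane) : ℝ :=
  sSup {θ : ℝ | ∃ A ∈ tangentPts K P, ∃ B ∈ tangentPts K P, θ = EuclideanGeometry.angle A P B}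

/-- The function `ω - sin ω - (2/3) sin³ ω` of the visual angle `ω = ω(P)`. -/
def angleIntegrand (K : Set Plane) (P : Plane) : ℝ :=
  visualAngle K P - Real.sin (visualAngle K P) - (2 / 3) * Real.sin (visualAngle K P) ^ 3

/-- `(5/4) L² + 5 ∫_{P ∉ K} (ω - sin ω - (2/3) sin³ ω) dP`. -/
def visualBound (K : Set Plane) : ℝ :=
  (5 / 4) * length K ^ 2 + 5 * ∫ P in Kᶜ, angleIntegrand K P

end Hurwitz

end

noncomputable section

namespace Hurwitz

open Set Filter Topology intervalIntegral

/-! Relative to an origin `P`, the set `K` has support function `supportFrom K P`. The point `P`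
lies outside `K` exactly when this function is negative somewhere. It then has two zeros per period,
φ and φ + τ with 0 < τ < π: these are the normal directions of the two tangents from `P`, and ω = π
- τ. In the coordinates (φ, τ) the exterior area element is `exteriorDensity`, the product of the
two tangent lengths divided by sin τ (`integral_exterior`).

Integrating over φ first leaves only the autocorrelation R = `corr p p`, its derivatives R' and R'',
and the integrals of p² and p'². Integrating over τ then gives Crofton's formula ∫ (ω - sin ω) =
L²/2 - πF (`integral_mul_gap_crofton`) and Hurwitz's formula ∫ sin³ω = 3L²/4 + 9q/4
(`integral_mul_gap_sin`), where q is the sum of the squares of the integrals of p cos 2φ and p sin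
2φ. So the visual bound equals 5Δ/4 - 15q/2. Length and area, defined by Hausdorff and Lebesgue
measure, are expressed through p in `length_eq` and `area_eq`.

What remains is a comparison of Fourier series (`hurwitz_inequality`). If x_n is the squared modulus
of the n-th Fourier coefficient of p, Parseval turns the visual bound into 5π² Σ (n² - 1) x_n and
the Hurwitz deficit into π² Σ (n² - 1)(n² - 4) x_n, both over |n| ≥ 3; the term -15q/2 removes
exactly n = ±2 from the first sum. Since n² - 4 ≥ 5 there, the inequality holds termwise. If the
first sum vanishes, so does every x_n with |n| ≥ 3, and hence the second sum. -/

/-- `p(φ + τ) - ⟨γ(φ), N(φ + τ)⟩`, the distance from `γ(φ)` to the support line of direction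
`φ + τ`. -/
def leadGap (p : ℝ → ℝ) (φ τ : ℝ) : ℝ := p (φ + τ) - p φ * cos τ - deriv p φ * sin τ

/-- `p(φ) - ⟨γ(φ + τ), N(φ)⟩`, the distance from `γ(φ + τ)` to the support line of direction
`φ`. -/
def trailGap (p : ℝ → ℝ) (φ τ : ℝ) : ℝ :=
  p φ - p (φ + τ) * cos τ + deriv p (φ + τ) * sin τ

/-- A `2π`-periodic function of class `C²` with everywhere positive radius of curvature. -/
structure IsSupport (p : ℝ → ℝ) : Prop where
  contDiff : ContDiff ℝ 2 p
  periodic : Function.Periodic p (2 * π)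
  radius_pos : ∀ φ, 0 < p φ + deriv (deriv p) φ

theorem exists_eq_add_of_angle (φ ψ : ℝ) : ∃ τ ∈ Ico 0 (2 * π), ∃ k : ℤ,
    ψ = φ + τ + k * (2 * π) := by
  refine ⟨toIcoMod two_pi_pos 0 (ψ - φ), by simpa using toIcoMod_mem_Ico two_pi_pos 0 (ψ - φ),
    toIcoDiv two_pi_pos 0 (ψ - φ), ?_⟩
  have := toIcoMod_add_toIcoDiv_zsmul two_pi_pos 0 (ψ - φ)
  rw [zsmul_eq_mul] at this
  linarith

/-! ### Calculus of support functions and positivity of the gaps. -/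

namespace IsSupport

variable {p : ℝ → ℝ}

theorem contDiff_deriv (hp : IsSupport p) : ContDiff ℝ 1 (deriv p) := by
  have h : ContDiff ℝ (1 + 1) p := by simpa [one_add_one_eq_two] using hp.contDiff
  exact (contDiff_succ_iff_deriv.1 h).2.2

theorem hasDerivAt (hp : IsSupport p) (x : ℝ) : HasDerivAt p (deriv p x) x :=
  (hp.contDiff.differentiable (by norm_num) x).hasDerivAt

theorem hasDerivAt_deriv (hp : IsSupport p) (x : ℝ) : HasDerivAt (deriv p) (deriv (deriv p) x) x :=
  (hp.contDiff_deriv.differentiable (by norm_num) x).hasDerivAt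

theorem continuous (hp : IsSupport p) : Continuous p := hp.contDiff.continuous

theorem continuous_deriv (hp : IsSupport p) : Continuous (deriv p) := hp.contDiff_deriv.continuous

theorem continuous_deriv2 (hp : IsSupport p) : Continuous (deriv (deriv p)) :=
  hp.contDiff_deriv.continuous_deriv le_rfl

theorem periodic_deriv (hp : IsSupport p) : Function.Periodic (deriv p) (2 * π) := fun x => by
  rw [← deriv_comp_add_const, show (fun x => p (x + 2 * π)) = p from funext hp.periodic]

theorem periodic_deriv2 (hp : IsSupport p) :
    Function.Periodic (deriv (deriv p)) (2 * π) := fun x => by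
  rw [← deriv_comp_add_const,
    show (fun x => deriv p (x + 2 * π)) = deriv p from funext hp.periodic_deriv]

/-- Variation of constants for p + p'' = ρ: the gap solves this equation in τ with zero initial
data. Positivity of the gap and its upper bound are both read off from this integral. -/
theorem leadGap_eq_integral (hp : IsSupport p) (φ τ : ℝ) :
    leadGap p φ τ = ∫ s in (0 : ℝ)..τ, (p (φ + s) + deriv (deriv p) (φ + s)) * sin (τ - s) := by
  have h0 := hp.continuous
  have h1 := hp.continuous_deriv
  have h2 := hp.continuous_deriv2
  have key : ∀ s ∈ uIcc 0 τ, HasDerivAt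
      (fun s => p (φ + s) * cos (τ - s) + deriv p (φ + s) * sin (τ - s))
      ((p (φ + s) + deriv (deriv p) (φ + s)) * sin (τ - s)) s := fun s _ => by
    have hs : HasDerivAt (fun s : ℝ => τ - s) (-1) s := by
      simpa using (hasDerivAt_id s).const_sub τ
    convert! (((hp.hasDerivAt (φ + s)).comp_const_add φ s).mul hs.cos).add
      (((hp.hasDerivAt_deriv (φ + s)).comp_const_add φ s).mul hs.sin) using 1
    ring
  rw [integral_eq_sub_of_hasDerivAt key (Continuous.intervalIntegrable (by fun_prop) _ _)]
  simp [leadGap]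
  ring

theorem trailGap_eq_integral (hp : IsSupport p) (φ τ : ℝ) :
    trailGap p φ τ = ∫ s in (0 : ℝ)..τ, (p (φ + s) + deriv (deriv p) (φ + s)) * sin s := by
  have h0 := hp.continuous
  have h1 := hp.continuous_deriv
  have h2 := hp.continuous_deriv2
  have key : ∀ s ∈ uIcc 0 τ, HasDerivAt
      (fun s => deriv p (φ + s) * sin s - p (φ + s) * cos s)
      ((p (φ + s) + deriv (deriv p) (φ + s)) * sin s) s := fun s _ => by
    convert! (((hp.hasDerivAt_deriv (φ + s)).comp_const_add φ s).mul (hasDerivAt_sin s)).sub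
      (((hp.hasDerivAt (φ + s)).comp_const_add φ s).mul (hasDerivAt_cos s)) using 1
    ring
  rw [integral_eq_sub_of_hasDerivAt key (Continuous.intervalIntegrable (by fun_prop) _ _)]
  simp [trailGap]
  ring

theorem leadGap_pos (hp : IsSupport p) (φ : ℝ) {τ : ℝ} (h : 0 < τ) (h' : τ ≤ π) :
    0 < leadGap p φ τ := by
  have h0 := hp.continuous
  have h2 := hp.continuous_deriv2
  rw [hp.leadGap_eq_integral]
  refine intervalIntegral_pos_of_pos_on (Continuous.intervalIntegrable (by fun_prop) _ _)
    (fun s hs => mul_pos (hp.radius_pos _) (sin_pos_of_pos_of_lt_pi ?_ ?_)) h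
  · linarith [hs.2]
  · linarith [hs.1]

theorem trailGap_pos (hp : IsSupport p) (φ : ℝ) {τ : ℝ} (h : 0 < τ) (h' : τ ≤ π) :
    0 < trailGap p φ τ := by
  have h0 := hp.continuous
  have h2 := hp.continuous_deriv2
  rw [hp.trailGap_eq_integral]
  exact intervalIntegral_pos_of_pos_on (Continuous.intervalIntegrable (by fun_prop) _ _)
    (fun s hs => mul_pos (hp.radius_pos _)
      (sin_pos_of_pos_of_lt_pi hs.1 (by linarith [hs.2]))) h

theorem exists_radius_le (hp : IsSupport p) : ∃ C, 0 < C ∧ ∀ φ, p φ + deriv (deriv p) φ ≤ C := by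
  have h0 := hp.continuous
  have h2 := hp.continuous_deriv2
  obtain ⟨x, hx⟩ := (isCompact_Icc (a := (0 : ℝ)) (b := 2 * π)).exists_isMaxOn
    (nonempty_Icc.2 (by positivity)) (f := fun φ => p φ + deriv (deriv p) φ)
    (by fun_prop)
  refine ⟨_, hp.radius_pos x, fun φ => ?_⟩
  have hper : Function.Periodic (fun φ => p φ + deriv (deriv p) φ) (2 * π) :=
    hp.periodic.add hp.periodic_deriv2
  obtain ⟨y, hy, hxy⟩ := hper.exists_mem_Ico₀ two_pi_pos φ
  have := hx.2 (Ico_subset_Icc_self hy)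
  rw [hxy]
  exact this

/-- Replacing the radius of curvature by its maximum in the integral formulas leaves C times the gap
of the unit circle. The factor 1 - cos τ records the second-order vanishing at τ = 0, needed for
integrability there. -/
theorem exists_gap_le (hp : IsSupport p) : ∃ C, 0 < C ∧ ∀ φ τ, 0 ≤ τ → τ ≤ π →
    leadGap p φ τ ≤ C * (1 - cos τ) ∧ trailGap p φ τ ≤ C * (1 - cos τ) := by
  obtain ⟨C, hC, hle⟩ := hp.exists_radius_le
  have h0 := hp.continuous
  have h2 := hp.continuous_deriv2
  refine ⟨C, hC, fun φ τ hτ hτ' => ⟨?_, ?_⟩⟩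
  · have hi : ∫ s in (0 : ℝ)..τ, C * sin (τ - s) = C * (1 - cos τ) := by
      rw [intervalIntegral.integral_const_mul, integral_comp_sub_left (fun x => sin x)]
      simp
    rw [hp.leadGap_eq_integral, ← hi]
    refine integral_mono_on hτ (Continuous.intervalIntegrable (by fun_prop) _ _)
      (Continuous.intervalIntegrable (by fun_prop) _ _) fun s hs => ?_
    exact mul_le_mul_of_nonneg_right (hle _)
      (sin_nonneg_of_nonneg_of_le_pi (by linarith [hs.2]) (by linarith [hs.1]))
  · have hi : ∫ s in (0 : ℝ)..τ, C * sin s = C * (1 - cos τ) := by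
      rw [intervalIntegral.integral_const_mul]
      simp
    rw [hp.trailGap_eq_integral, ← hi]
    refine integral_mono_on hτ (Continuous.intervalIntegrable (by fun_prop) _ _)
      (Continuous.intervalIntegrable (by fun_prop) _ _) fun s hs => ?_
    exact mul_le_mul_of_nonneg_right (hle _)
      (sin_nonneg_of_nonneg_of_le_pi hs.1 (by linarith [hs.2]))

/-- The gap vanishes only for coinciding directions. -/
theorem leadGap_pos_of_lt (hp : IsSupport p) (φ : ℝ) {τ : ℝ} (h : 0 < τ) (h' : τ < 2 * π) :
    0 < leadGap p φ τ := by
  rcases le_or_gt τ π with h1 | h1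
  · exact hp.leadGap_pos φ h h1
  -- For τ > π the same distance is the trailing gap of the complementary arc, from φ + τ to φ + 2π,
  -- which is shorter than π.
  · have := hp.trailGap_pos (φ + τ) (τ := 2 * π - τ) (by linarith) (by linarith)
    unfold trailGap at this
    rw [cos_two_pi_sub, sin_two_pi_sub, show φ + τ + (2 * π - τ) = φ + 2 * π by ring,
      hp.periodic, hp.periodic_deriv] at this
    unfold leadGap
    linarith

end IsSupport

/-! ### Zeros of a support function: the two tangents through a point. -/

namespace IsSupport

variable {p : ℝ → ℝ}

/-- At two zeros less than π apart the gap reduces to -p'(φ) sin τ. So the first zero of such a pair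
is a descent and, by the next lemma, the second an ascent; this sign rule gives all the uniqueness
statements. -/
theorem deriv_neg_of_zeros (hp : IsSupport p) {φ τ : ℝ} (h : 0 < τ) (h' : τ < π) (h0 : p φ = 0)
    (h1 : p (φ + τ) = 0) : deriv p φ < 0 := by
  have := hp.leadGap_pos φ h h'.le
  have hs := sin_pos_of_pos_of_lt_pi h h'
  rw [leadGap, h0, h1] at this
  nlinarith

theorem deriv_pos_of_zeros (hp : IsSupport p) {φ τ : ℝ} (h : 0 < τ) (h' : τ < π) (h0 : p φ = 0)
    (h1 : p (φ + τ) = 0) : 0 < deriv p (φ + τ) := by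
  have := hp.trailGap_pos φ h h'.le
  have hs := sin_pos_of_pos_of_lt_pi h h'
  rw [trailGap, h0, h1] at this
  nlinarith

/-- The width of the body is positive: it is the leading gap at τ = π. -/
theorem add_pi_pos (hp : IsSupport p) (φ : ℝ) : 0 < p φ + p (φ + π) := by
  have := hp.leadGap_pos φ pi_pos le_rfl
  simp only [leadGap, cos_pi, sin_pi] at this
  linarith

theorem exists_neg_of_zeros (hp : IsSupport p) {φ τ : ℝ} (h : 0 < τ) (h' : τ < π) (h0 : p φ = 0)
    (h1 : p (φ + τ) = 0) : ∃ ψ, p ψ < 0 := by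
  by_contra! hc
  have hmin : IsLocalMin p φ := Filter.Eventually.of_forall fun x => h0 ▸ hc x
  exact (hp.deriv_neg_of_zeros h h' h0 h1).ne hmin.deriv_eq_zero

/-- Positive width makes p positive at ψ - π, giving a zero φ before ψ, and then positive at φ + π,
giving a zero after ψ. Choosing the second zero before φ + π forces τ < π. -/
theorem exists_zeros_of_neg (hp : IsSupport p) {ψ : ℝ} (h : p ψ < 0) :
    ∃ φ τ, 0 < τ ∧ τ < π ∧ p φ = 0 ∧ p (φ + τ) = 0 := by
  have ha : 0 < p (ψ - π) := by
    have := hp.add_pi_pos (ψ - π)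
    rw [sub_add_cancel] at this
    linarith
  obtain ⟨φ, hφ, h0⟩ := intermediate_value_Ioo' (by linarith [pi_pos] : ψ - π ≤ ψ)
    hp.continuous.continuousOn ⟨h, ha⟩
  have hb : 0 < p (φ + π) := by
    have := hp.add_pi_pos φ
    linarith
  obtain ⟨χ, hχ, h1⟩ := intermediate_value_Ioo (by linarith [hφ.1] : ψ ≤ φ + π)
    hp.continuous.continuousOn ⟨h, hb⟩
  exact ⟨φ, χ - φ, by linarith [hφ.2, hχ.1], by linarith [hχ.2], h0, by
    rw [add_sub_cancel]; exact h1⟩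

/-- Of three zeros within an arc shorter than π, the middle one would be both an ascent and a
descent. -/
theorem zeros_unique (hp : IsSupport p) {φ τ σ : ℝ} (h : 0 < τ) (h' : τ < π) (hσ : 0 < σ)
    (hσ' : σ ≤ π) (h0 : p φ = 0) (h1 : p (φ + τ) = 0) (h2 : p (φ + σ) = 0) : σ = τ := by
  have hσπ : σ < π := by
    refine lt_of_le_of_ne hσ' fun he => ?_
    have := hp.add_pi_pos φ
    rw [h0, ← he, h2] at this
    simp at this
  rcases lt_trichotomy σ τ with hlt | heq | hlt
  · have ha := hp.deriv_pos_of_zeros hσ hσπ h0 h2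
    have hb := hp.deriv_neg_of_zeros (φ := φ + σ) (τ := τ - σ) (by linarith) (by linarith) h2
      (by rw [show φ + σ + (τ - σ) = φ + τ by ring, h1])
    linarith
  · exact heq
  · have ha := hp.deriv_pos_of_zeros h h' h0 h1
    have hb := hp.deriv_neg_of_zeros (φ := φ + τ) (τ := σ - τ) (by linarith) (by linarith) h1
      (by rw [show φ + τ + (σ - τ) = φ + σ by ring, h2])
    linarith

theorem zeros_eq (hp : IsSupport p) {φ τ ψ : ℝ} (h : 0 < τ) (h' : τ < π) (h0 : p φ = 0)
    (h1 : p (φ + τ) = 0) (h2 : p ψ = 0) :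
    ∃ k : ℤ, ψ = φ + k * (2 * π) ∨ ψ = φ + τ + k * (2 * π) := by
  obtain ⟨σ, hσ, k, rfl⟩ := exists_eq_add_of_angle φ ψ
  refine ⟨k, ?_⟩
  rw [hp.periodic.int_mul] at h2
  rcases hσ.1.eq_or_lt with rfl | hpos
  · left; ring
  · rcases le_or_gt σ π with hle | hgt
    · right
      rw [hp.zeros_unique h h' hpos hle h0 h1 h2]
    -- A zero more than π after φ is less than π before φ + 2π, which would make φ an ascent.
    · have ha := hp.deriv_pos_of_zeros (φ := φ + σ) (τ := 2 * π - σ) (by linarith [hσ.2])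
        (by linarith) h2 (by rw [show φ + σ + (2 * π - σ) = φ + 2 * π by ring, hp.periodic, h0])
      rw [show φ + σ + (2 * π - σ) = φ + 2 * π by ring, hp.periodic_deriv] at ha
      linarith [hp.deriv_neg_of_zeros h h' h0 h1]

theorem zero_pair_unique (hp : IsSupport p) {φ τ φ' τ' : ℝ} (h : 0 < τ) (h' : τ < π)
    (h0 : p φ = 0) (h1 : p (φ + τ) = 0) (hτ : 0 < τ') (hτ' : τ' < π) (h2 : p φ' = 0)
    (h3 : p (φ' + τ') = 0) : (∃ k : ℤ, φ' = φ + k * (2 * π)) ∧ τ' = τ := by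
  obtain ⟨k, rfl | rfl⟩ := hp.zeros_eq h h' h0 h1 h2
  · refine ⟨⟨k, rfl⟩, hp.zeros_unique h h' hτ hτ'.le h0 h1 ?_⟩
    rwa [add_right_comm, hp.periodic.int_mul] at h3
  · have ha := hp.deriv_neg_of_zeros hτ hτ' h2 h3
    rw [hp.periodic_deriv.int_mul] at ha
    linarith [hp.deriv_pos_of_zeros h h' h0 h1]

end IsSupport

/-! ### Geometry of `K`: boundary points, tangents and visual angle. -/

/-- Two angles in a half-open period that differ by a multiple of `2π` coincide. -/
theorem eq_of_eq_add_int_mul {φ ψ : ℝ} (hφ : φ ∈ Ico 0 (2 * π)) (hψ : ψ ∈ Ico 0 (2 * π)) {k : ℤ}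
    (h : ψ = φ + k * (2 * π)) : ψ = φ := by
  have h1 : -1 < (k : ℝ) := by nlinarith [pi_pos, hφ.1, hφ.2, hψ.1, hψ.2]
  have h2 : (k : ℝ) < 1 := by nlinarith [pi_pos, hφ.1, hφ.2, hψ.1, hψ.2]
  have h3 : k = 0 := by
    have : -1 < k := by exact_mod_cast h1
    have : k < 1 := by exact_mod_cast h2
    omega
  simp [h, h3]

theorem inner_N (x : Plane) (φ : ℝ) : inner ℝ x (N φ) = x 0 * cos φ + x 1 * sin φ := by
  simp [N, PiLp.inner_apply, Fin.sum_univ_two, mul_comm]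

theorem inner_N' (x : Plane) (φ : ℝ) : inner ℝ x (N' φ) = -x 0 * sin φ + x 1 * cos φ := by
  simp [N', PiLp.inner_apply, Fin.sum_univ_two, mul_comm]

theorem N_add_int_mul (φ : ℝ) (k : ℤ) : N (φ + k * (2 * π)) = N φ := by
  simp [N, cos_add_int_mul_two_pi, sin_add_int_mul_two_pi]

theorem N'_add_int_mul (φ : ℝ) (k : ℤ) : N' (φ + k * (2 * π)) = N' φ := by
  simp [N', cos_add_int_mul_two_pi, sin_add_int_mul_two_pi]

theorem supportFn_periodic (K : Set Plane) : Function.Periodic (supportFn K) (2 * π) := fun φ => by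
  simp [supportFn, N]

/-- A vector of the plane is determined by its coordinates in the frame `(N φ, N' φ)`. -/
theorem eq_smul_N_add_smul_N' (x : Plane) (φ : ℝ) :
    x = (inner ℝ x (N φ) : ℝ) • N φ + (inner ℝ x (N' φ) : ℝ) • N' φ := by
  have h := sin_sq_add_cos_sq φ
  rw [inner_N, inner_N']
  ext i
  fin_cases i
  · simp [N, N']
    linear_combination (-x 0) * h
  · simp [N, N']
    linear_combination (-x 1) * h

theorem norm_N (φ : ℝ) : ‖N φ‖ = 1 := by
  rw [EuclideanSpace.norm_eq]
  simp [N, Fin.sum_univ_two]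

theorem norm_N' (φ : ℝ) : ‖N' φ‖ = 1 := by
  rw [EuclideanSpace.norm_eq]
  simp [N', Fin.sum_univ_two]

theorem exists_eq_smul_N (v : Plane) : ∃ r φ : ℝ, 0 ≤ r ∧ v = r • N φ := by
  refine ⟨‖(⟨v 0, v 1⟩ : ℂ)‖, Complex.arg ⟨v 0, v 1⟩, norm_nonneg _, ?_⟩
  ext i
  fin_cases i
  · simp [N, Complex.norm_mul_cos_arg]
  · simp [N, Complex.norm_mul_sin_arg]

/-- The support function of `K` with respect to the point `P` as origin. -/
def supportFrom (K : Set Plane) (P : Plane) (φ : ℝ) : ℝ := supportFn K φ - inner ℝ P (N φ)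

theorem hasDerivAt_inner_N (P : Plane) (φ : ℝ) :
    HasDerivAt (fun φ => (inner ℝ P (N φ) : ℝ)) (inner ℝ P (N' φ)) φ := by
  simp only [inner_N, inner_N']
  convert! ((hasDerivAt_cos φ).const_mul (P 0)).add ((hasDerivAt_sin φ).const_mul (P 1)) using 1
  ring

theorem hasDerivAt_inner_N' (P : Plane) (φ : ℝ) :
    HasDerivAt (fun φ => (inner ℝ P (N' φ) : ℝ)) (-inner ℝ P (N φ)) φ := by
  simp only [inner_N, inner_N']
  convert! ((hasDerivAt_sin φ).const_mul (-P 0)).add ((hasDerivAt_cos φ).const_mul (P 1)) using 1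
  ring

theorem inner_boundaryPt (K : Set Plane) (φ τ : ℝ) :
    inner ℝ (boundaryPt K φ) (N (φ + τ)) = supportFn K (φ + τ) - leadGap (supportFn K) φ τ := by
  have h := sin_sq_add_cos_sq φ
  rw [inner_N]
  simp [leadGap, boundaryPt, N, N', cos_add, sin_add]
  linear_combination (supportFn K φ * cos τ + deriv (supportFn K) φ * sin τ) * h

theorem inner_boundaryPt_self (K : Set Plane) (φ : ℝ) :
    inner ℝ (boundaryPt K φ) (N φ) = supportFn K φ := by
  simpa [leadGap] using inner_boundaryPt K φ 0

theorem inner_boundaryPt_N' (K : Set Plane) (φ : ℝ) :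
    inner ℝ (boundaryPt K φ) (N' φ) = deriv (supportFn K) φ := by
  have h := sin_sq_add_cos_sq φ
  rw [inner_N']
  simp [boundaryPt, N, N']
  linear_combination (deriv (supportFn K) φ) * h

namespace IsStrictlyConvexC2

variable {K : Set Plane}

theorem isSupport (hK : IsStrictlyConvexC2 K) : IsSupport (supportFn K) :=
  ⟨hK.contDiff, supportFn_periodic K, hK.radius_pos⟩

theorem deriv_supportFrom (hK : IsStrictlyConvexC2 K) (P : Plane) :
    deriv (supportFrom K P) = fun φ => deriv (supportFn K) φ - inner ℝ P (N' φ) :=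
  funext fun φ => ((hK.isSupport.hasDerivAt φ).sub (hasDerivAt_inner_N P φ)).deriv

theorem isSupport_from (hK : IsStrictlyConvexC2 K) (P : Plane) : IsSupport (supportFrom K P) := by
  refine ⟨?_, fun φ => ?_, fun φ => ?_⟩
  · unfold supportFrom
    simp only [inner_N]
    have := hK.contDiff
    have := contDiff_cos (n := 2)
    have := contDiff_sin (n := 2)
    fun_prop
  · simp [supportFrom, supportFn_periodic K φ, N]
  · rw [hK.deriv_supportFrom,
      ((hK.isSupport.hasDerivAt_deriv φ).fun_sub (hasDerivAt_inner_N' P φ)).deriv, supportFrom]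
    linarith [hK.radius_pos φ]

theorem bddAbove (hK : IsStrictlyConvexC2 K) (φ : ℝ) :
    BddAbove ((fun x : Plane => (inner ℝ x (N φ) : ℝ)) '' K) :=
  (hK.isCompact.image (by fun_prop)).bddAbove

theorem inner_le (hK : IsStrictlyConvexC2 K) {x : Plane} (hx : x ∈ K) (φ : ℝ) :
    inner ℝ x (N φ) ≤ supportFn K φ :=
  le_csSup (hK.bddAbove φ) ⟨x, hx, rfl⟩

theorem exists_inner_eq (hK : IsStrictlyConvexC2 K) (φ : ℝ) :
    ∃ x ∈ K, inner ℝ x (N φ) = supportFn K φ :=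
  (hK.isCompact.image (f := fun x : Plane => (inner ℝ x (N φ) : ℝ)) (by fun_prop)).sSup_mem
    (hK.nonempty.image _)

/-- A compact convex set is the intersection of its supporting half-planes, by Hahn-Banach
separation. -/
theorem mem_iff (hK : IsStrictlyConvexC2 K) {x : Plane} :
    x ∈ K ↔ ∀ φ, inner ℝ x (N φ) ≤ supportFn K φ := by
  refine ⟨fun hx => hK.inner_le hx, fun h => ?_⟩
  by_contra hx
  obtain ⟨f, u, h1, h2⟩ := geometric_hahn_banach_closed_point hK.convex hK.isCompact.isClosed hx
  obtain ⟨v, rfl⟩ := (InnerProductSpace.toDual ℝ Plane).surjective f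
  obtain ⟨r, φ, hr, rfl⟩ := exists_eq_smul_N v
  simp only [InnerProductSpace.toDual_apply_apply, real_inner_smul_left] at h1 h2
  obtain ⟨y, hy, hyφ⟩ := hK.exists_inner_eq φ
  have h3 := h1 y hy
  rw [real_inner_comm] at h3 h2
  rw [hyφ] at h3
  have := mul_le_mul_of_nonneg_left (h φ) hr
  linarith

theorem notMem_iff (hK : IsStrictlyConvexC2 K) {P : Plane} :
    P ∉ K ↔ ∃ φ, supportFrom K P φ < 0 := by
  simp [hK.mem_iff, supportFrom]

/-- A contact point x makes p - ⟨x, N⟩ minimal, with value 0, at φ. The vanishing derivative fixes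
the tangential coordinate of x, so each support line touches `K` at one point only. -/
theorem eq_boundaryPt (hK : IsStrictlyConvexC2 K) {x : Plane} (hx : x ∈ K) {φ : ℝ}
    (h : inner ℝ x (N φ) = supportFn K φ) : x = boundaryPt K φ := by
  have hmin : IsLocalMin (supportFrom K x) φ := Filter.Eventually.of_forall fun ψ => by
    have := hK.inner_le hx ψ
    simp only [supportFrom, h]
    linarith
  have h0 := hmin.deriv_eq_zero
  rw [hK.deriv_supportFrom] at h0
  have h1 : inner ℝ x (N' φ) = deriv (supportFn K) φ := by
    simp only at h0; linarith
  rw [eq_smul_N_add_smul_N' x φ, h, h1, boundaryPt]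

theorem boundaryPt_mem (hK : IsStrictlyConvexC2 K) (φ : ℝ) : boundaryPt K φ ∈ K := by
  obtain ⟨x, hx, h⟩ := hK.exists_inner_eq φ
  rwa [← hK.eq_boundaryPt hx h]

theorem boundaryPt_add_int_mul (hK : IsStrictlyConvexC2 K) (φ : ℝ) (k : ℤ) :
    boundaryPt K (φ + k * (2 * π)) = boundaryPt K φ := by
  rw [boundaryPt, N_add_int_mul, N'_add_int_mul, hK.isSupport.periodic.int_mul,
    hK.isSupport.periodic_deriv.int_mul, boundaryPt]

theorem inner_boundaryPt_eq_iff (hK : IsStrictlyConvexC2 K) {φ ψ : ℝ} :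
    inner ℝ (boundaryPt K φ) (N ψ) = supportFn K ψ ↔ ∃ k : ℤ, ψ = φ + k * (2 * π) := by
  constructor
  · intro h
    obtain ⟨τ, hτ, k, rfl⟩ := exists_eq_add_of_angle φ ψ
    refine ⟨k, ?_⟩
    rw [N_add_int_mul, hK.isSupport.periodic.int_mul, inner_boundaryPt] at h
    rcases hτ.1.eq_or_lt with rfl | hpos
    · ring
    · linarith [hK.isSupport.leadGap_pos_of_lt φ hpos hτ.2]
  · rintro ⟨k, rfl⟩
    rw [N_add_int_mul, inner_boundaryPt_self, hK.isSupport.periodic.int_mul]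

theorem injOn_boundaryPt (hK : IsStrictlyConvexC2 K) :
    InjOn (boundaryPt K) (Ico 0 (2 * π)) := fun φ hφ ψ hψ h => by
  obtain ⟨k, hk⟩ := hK.inner_boundaryPt_eq_iff.1 (h ▸ inner_boundaryPt_self K ψ)
  exact (eq_of_eq_add_int_mul hφ hψ hk).symm

theorem mem_frontier_iff (hK : IsStrictlyConvexC2 K) {x : Plane} :
    x ∈ frontier K ↔ x ∈ K ∧ ∃ φ, inner ℝ x (N φ) = supportFn K φ := by
  rw [hK.isCompact.isClosed.frontier_eq]
  refine and_congr_right fun hx => ⟨fun hint => ?_, ?_⟩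
  · by_contra! hne
    have hs := hK.isSupport_from x
    obtain ⟨φ₀, -, hφ₀⟩ := (isCompact_Icc (a := (0 : ℝ)) (b := 2 * π)).exists_isMinOn
      (nonempty_Icc.2 (by positivity)) hs.continuous.continuousOn
    have hpos : 0 < supportFrom K x φ₀ :=
      sub_pos.2 (lt_of_le_of_ne (hK.inner_le hx φ₀) (hne φ₀))
    -- The minimal distance from x to the support lines is the radius of a ball contained in `K`.
    refine hint (mem_interior_iff_mem_nhds.2 (Metric.mem_nhds_iff.2 ⟨_, hpos, fun y hy => ?_⟩))
    rw [hK.mem_iff]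
    intro φ
    obtain ⟨χ, hχ, he⟩ := hs.periodic.exists_mem_Ico₀ two_pi_pos φ
    have h1 : supportFrom K x φ₀ ≤ supportFrom K x φ := he ▸ hφ₀ (Ico_subset_Icc_self hχ)
    have h2 : (inner ℝ (y - x) (N φ) : ℝ) ≤ ‖y - x‖ * ‖N φ‖ := real_inner_le_norm _ _
    rw [norm_N, mul_one, ← dist_eq_norm, inner_sub_left] at h2
    rw [Metric.mem_ball] at hy
    unfold supportFrom at *
    linarith
  · rintro ⟨φ, hφ⟩ hint
    have hc : ContinuousAt (fun t : ℝ => x + t • N φ) 0 := by fun_prop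
    have hev : ∀ᶠ t : ℝ in 𝓝 0, x + t • N φ ∈ K :=
      hc (by simpa using mem_interior_iff_mem_nhds.1 hint)
    obtain ⟨ε, hε, hb⟩ := Metric.eventually_nhds_iff.1 hev
    have h1 := hK.inner_le (hb (y := ε / 2)
      (by rw [dist_zero_right, Real.norm_eq_abs, abs_of_pos (by positivity)]; linarith)) φ
    rw [inner_add_left, real_inner_smul_left, real_inner_self_eq_norm_sq, norm_N, hφ] at h1
    linarith

theorem frontier_eq_image (hK : IsStrictlyConvexC2 K) :
    frontier K = boundaryPt K '' Ico 0 (2 * π) := by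
  ext x
  rw [hK.mem_frontier_iff]
  constructor
  · rintro ⟨hx, φ, hφ⟩
    obtain ⟨τ, hτ, k, hk⟩ := exists_eq_add_of_angle 0 φ
    refine ⟨τ, hτ, ?_⟩
    rw [hK.eq_boundaryPt hx hφ, hk, hK.boundaryPt_add_int_mul, zero_add]
  · rintro ⟨φ, -, rfl⟩
    exact ⟨hK.boundaryPt_mem φ, φ, inner_boundaryPt_self K φ⟩

/-- The points of contact of the two tangents through `P`. -/
theorem tangentPts_eq (hK : IsStrictlyConvexC2 K) {P : Plane} {φ τ : ℝ} (h : 0 < τ) (h' : τ < π)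
    (h0 : supportFrom K P φ = 0) (h1 : supportFrom K P (φ + τ) = 0) :
    tangentPts K P = {boundaryPt K φ, boundaryPt K (φ + τ)} := by
  ext A
  simp only [tangentPts, mem_ofPred_eq, mem_insert_iff, mem_singleton_iff]
  constructor
  · rintro ⟨hA, ψ, hAψ, hPψ⟩
    rw [hK.eq_boundaryPt (hK.mem_frontier_iff.1 hA).1 hAψ]
    have h2 : supportFrom K P ψ = 0 := by rw [supportFrom, hPψ, sub_self]
    obtain ⟨k, rfl | rfl⟩ := (hK.isSupport_from P).zeros_eq h h' h0 h1 h2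
    · left; exact hK.boundaryPt_add_int_mul _ _
    · right; exact hK.boundaryPt_add_int_mul _ _
  · have key : ∀ ψ, supportFrom K P ψ = 0 → boundaryPt K ψ ∈ frontier K ∧ ∃ φ,
        inner ℝ (boundaryPt K ψ) (N φ) = supportFn K φ ∧ inner ℝ P (N φ) = supportFn K φ :=
      fun ψ hψ => ⟨hK.mem_frontier_iff.2 ⟨hK.boundaryPt_mem ψ, ψ, inner_boundaryPt_self K ψ⟩, ψ,
        inner_boundaryPt_self K ψ, by unfold supportFrom at hψ; linarith⟩
    rintro (rfl | rfl)
    · exact key _ h0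
    · exact key _ h1

theorem boundaryPt_sub (hK : IsStrictlyConvexC2 K) {P : Plane} {φ : ℝ}
    (h0 : supportFrom K P φ = 0) :
    boundaryPt K φ - P = deriv (supportFrom K P) φ • N' φ := by
  rw [eq_smul_N_add_smul_N' (boundaryPt K φ - P) φ, inner_sub_left, inner_sub_left,
    inner_boundaryPt_self, inner_boundaryPt_N', hK.deriv_supportFrom]
  unfold supportFrom at h0
  rw [h0, zero_smul, zero_add]

/-- The vectors from `P` to the contact points are a negative multiple of N'(φ) and a positive
multiple of N'(φ + τ). The directions N' make the angle τ, so the sign change turns it into π - τ.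
-/
theorem visualAngle_eq (hK : IsStrictlyConvexC2 K) {P : Plane} {φ τ : ℝ} (h : 0 < τ) (h' : τ < π)
    (h0 : supportFrom K P φ = 0) (h1 : supportFrom K P (φ + τ) = 0) :
    visualAngle K P = π - τ := by
  have hs := hK.isSupport_from P
  have ha := hs.deriv_neg_of_zeros h h' h0 h1
  have hb := hs.deriv_pos_of_zeros h h' h0 h1
  have hang : EuclideanGeometry.angle (boundaryPt K φ) P (boundaryPt K (φ + τ)) = π - τ := by
    rw [EuclideanGeometry.angle, vsub_eq_sub, vsub_eq_sub, hK.boundaryPt_sub h0,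
      hK.boundaryPt_sub h1, InnerProductGeometry.angle_smul_right_of_pos _ _ hb,
      InnerProductGeometry.angle_smul_left_of_neg _ _ ha, InnerProductGeometry.angle_neg_left,
      InnerProductGeometry.angle, norm_N', norm_N', inner_N']
    have hcos : -(N' φ).ofLp 0 * sin (φ + τ) + (N' φ).ofLp 1 * cos (φ + τ) = cos τ := by
      have h := sin_sq_add_cos_sq φ
      simp [N', cos_add, sin_add]
      linear_combination (cos τ) * h
    rw [hcos, mul_one, div_one, arccos_cos h.le h'.le]
  have hP1 : boundaryPt K φ ≠ P := fun he => by
    have := hK.boundaryPt_sub h0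
    rw [he, sub_self] at this
    have h2 := congrArg norm this
    rw [norm_zero, norm_smul, norm_N', mul_one, Real.norm_eq_abs, abs_of_neg ha] at h2
    linarith
  have hP2 : boundaryPt K (φ + τ) ≠ P := fun he => by
    have := hK.boundaryPt_sub h1
    rw [he, sub_self] at this
    have h2 := congrArg norm this
    rw [norm_zero, norm_smul, norm_N', mul_one, Real.norm_eq_abs, abs_of_pos hb] at h2
    linarith
  rw [visualAngle, hK.tangentPts_eq h h' h0 h1]
  refine IsGreatest.csSup_eq ⟨⟨_, by simp, _, by simp, hang.symm⟩, ?_⟩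
  rintro θ ⟨A, hA, B, hB, rfl⟩
  rcases hA with rfl | rfl <;> rcases hB with rfl | rfl
  · rw [EuclideanGeometry.angle_self_of_ne hP1]; linarith
  · exact hang.le
  · rw [EuclideanGeometry.angle_comm]; exact hang.le
  · rw [EuclideanGeometry.angle_self_of_ne hP2]; linarith

end IsStrictlyConvexC2

/-! ### Length: Hausdorff measure of the boundary and Cauchy's formula. -/

/-- Comparison of one-dimensional Hausdorff measures of two images of the same set. -/
theorem hausdorffMeasure_image_le_image {α X Y : Type*} [MetricSpace X] [MeasurableSpace X]
    [BorelSpace X] [MetricSpace Y] [MeasurableSpace Y] [BorelSpace Y] (f : α → X) (g : α → Y)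
    (S : Set α) (C : NNReal)
    (h : ∀ x ∈ S, ∀ y ∈ S, dist (f x) (f y) ≤ C * dist (g x) (g y)) :
    Measure.hausdorffMeasure 1 (f '' S) ≤ C * Measure.hausdorffMeasure 1 (g '' S) := by
  rcases S.eq_empty_or_nonempty with rfl | ⟨x₀, -⟩
  · simp
  have : Nonempty α := ⟨x₀⟩
  -- The hypothesis makes f x depend only on g x on S, so f factors through g by a C-Lipschitz map.
  have him : ∀ x ∈ S, f (Function.invFunOn g S (g x)) = f x := fun x hx => by
    have hm : g x ∈ g '' S := ⟨x, hx, rfl⟩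
    have h1 := h _ (Function.invFunOn_mem hm) _ hx
    rw [Function.invFunOn_eq hm, dist_self, mul_zero] at h1
    exact dist_le_zero.1 h1
  have hL : LipschitzOnWith C (fun y => f (Function.invFunOn g S y)) (g '' S) := by
    refine LipschitzOnWith.of_dist_le_mul ?_
    rintro _ ⟨x, hx, rfl⟩ _ ⟨y, hy, rfl⟩
    simp only [him x hx, him y hy]
    exact h x hx y hy
  have h2 := hL.hausdorffMeasure_image_le (d := 1) zero_le_one
  rw [ENNReal.rpow_one, image_image, image_congr him] at h2
  exact h2

/-- The arc length of `Γ` between the directions `0` and `φ`. -/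
def arcLength (K : Set Plane) (φ : ℝ) : ℝ :=
  ∫ s in (0 : ℝ)..φ, (supportFn K s + deriv (deriv (supportFn K)) s)

namespace IsStrictlyConvexC2

variable {K : Set Plane}

theorem hasDerivAt_arcLength (hK : IsStrictlyConvexC2 K) (φ : ℝ) :
    HasDerivAt (arcLength K) (supportFn K φ + deriv (deriv (supportFn K)) φ) φ := by
  have hc : Continuous fun s => supportFn K s + deriv (deriv (supportFn K)) s :=
    hK.isSupport.continuous.add hK.isSupport.continuous_deriv2
  exact hc.integral_hasStrictDerivAt 0 φ |>.hasDerivAt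

theorem continuous_arcLength (hK : IsStrictlyConvexC2 K) : Continuous (arcLength K) :=
  continuous_iff_continuousAt.2 fun φ => (hK.hasDerivAt_arcLength φ).continuousAt

theorem strictMono_arcLength (hK : IsStrictlyConvexC2 K) : StrictMono (arcLength K) :=
  strictMono_of_hasDerivAt_pos hK.hasDerivAt_arcLength hK.radius_pos

theorem hasDerivAt_inner_boundaryPt (hK : IsStrictlyConvexC2 K) (ψ φ : ℝ) :
    HasDerivAt (fun φ => (inner ℝ (boundaryPt K φ) (N ψ) : ℝ))
      ((supportFn K φ + deriv (deriv (supportFn K)) φ) * sin (ψ - φ)) φ := by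
  have heq : (fun φ => (inner ℝ (boundaryPt K φ) (N ψ) : ℝ)) =
      fun φ => supportFn K φ * cos (ψ - φ) + deriv (supportFn K) φ * sin (ψ - φ) := by
    ext φ
    have := inner_boundaryPt K φ (ψ - φ)
    rw [add_sub_cancel] at this
    rw [this, leadGap, add_sub_cancel]
    ring
  have hs : HasDerivAt (fun s : ℝ => ψ - s) (-1) φ := by
    simpa using (hasDerivAt_id φ).const_sub ψ
  rw [heq]
  convert! ((hK.isSupport.hasDerivAt φ).mul hs.cos).add
    ((hK.isSupport.hasDerivAt_deriv φ).mul hs.sin) using 1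
  ring

/-- Projection to the chord direction turns the chord into an integral of ρ times a sine, hence at
most the integral of ρ. -/
theorem dist_boundaryPt_le (hK : IsStrictlyConvexC2 K) {s t : ℝ} (hst : s ≤ t) :
    dist (boundaryPt K t) (boundaryPt K s) ≤ arcLength K t - arcLength K s := by
  obtain ⟨r, ψ, hr, he⟩ := exists_eq_smul_N (boundaryPt K t - boundaryPt K s)
  have hmono : Monotone fun φ => arcLength K φ - inner ℝ (boundaryPt K φ) (N ψ) :=
    monotone_of_hasDerivAt_nonneg
      (fun φ => (hK.hasDerivAt_arcLength φ).sub (hK.hasDerivAt_inner_boundaryPt ψ φ))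
      fun φ => by
        have := mul_nonneg (hK.radius_pos φ).le (sub_nonneg.2 (sin_le_one (ψ - φ)))
        simp only [Pi.zero_apply]
        linarith
  have h1 := hmono hst
  have h2 : (inner ℝ (boundaryPt K t - boundaryPt K s) (N ψ) : ℝ) = r := by
    rw [he, real_inner_smul_left, real_inner_self_eq_norm_sq, norm_N]; ring
  rw [inner_sub_left] at h2
  rw [dist_eq_norm, he, norm_smul, norm_N, mul_one, Real.norm_eq_abs, abs_of_nonneg hr]
  simp only at h1
  linarith

/-- Projection to N(s + π/2), the tangent direction at s: over a turning angle at most h the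
projected speed is at least ρ cos h. -/
theorem le_dist_boundaryPt (hK : IsStrictlyConvexC2 K) {s t h : ℝ} (hst : s ≤ t) (hth : t ≤ s + h)
    (hh : h ≤ π) :
    cos h * (arcLength K t - arcLength K s) ≤ dist (boundaryPt K t) (boundaryPt K s) := by
  have hd : ∀ φ, HasDerivAt
      (fun φ => inner ℝ (boundaryPt K φ) (N (s + π / 2)) - cos h * arcLength K φ) _ φ :=
    fun φ => (hK.hasDerivAt_inner_boundaryPt (s + π / 2) φ).sub
      ((hK.hasDerivAt_arcLength φ).const_mul (cos h))
  have hmono : MonotoneOn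
      (fun φ => inner ℝ (boundaryPt K φ) (N (s + π / 2)) - cos h * arcLength K φ)
      (Icc s (s + h)) := by
    refine monotoneOn_of_hasDerivWithinAt_nonneg (convex_Icc _ _)
      (fun φ _ => (hd φ).continuousAt.continuousWithinAt)
      (fun φ _ => (hd φ).hasDerivWithinAt) fun φ hφ => ?_
    rw [interior_Icc] at hφ
    have h1 : sin (s + π / 2 - φ) = cos (φ - s) := by
      rw [← sin_pi_div_two_sub]; congr 1; ring
    have h2 : cos h ≤ cos (φ - s) :=
      cos_le_cos_of_nonneg_of_le_pi (by linarith [hφ.1]) hh (by linarith [hφ.2])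
    have := mul_nonneg (hK.radius_pos φ).le (sub_nonneg.2 h2)
    rw [h1]
    linarith
  have h1 := hmono ⟨le_rfl, by linarith⟩ ⟨hst, hth⟩ hst
  have h2 : (inner ℝ (boundaryPt K t - boundaryPt K s) (N (s + π / 2)) : ℝ) ≤ _ :=
    real_inner_le_norm _ _
  rw [inner_sub_left, norm_N, mul_one, ← dist_eq_norm] at h2
  simp only at h1
  linarith

theorem continuous_boundaryPt (hK : IsStrictlyConvexC2 K) : Continuous (boundaryPt K) := by
  have h0 := hK.isSupport.continuous
  have h1 := hK.isSupport.continuous_deriv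
  unfold boundaryPt N N'
  fun_prop

theorem dist_arcLength (hK : IsStrictlyConvexC2 K) {s t : ℝ} (hst : s ≤ t) :
    dist (arcLength K t) (arcLength K s) = arcLength K t - arcLength K s := by
  rw [Real.dist_eq, abs_of_nonneg (sub_nonneg.2 (hK.strictMono_arcLength.monotone hst))]

theorem hausdorffMeasure_arcLength_image (hK : IsStrictlyConvexC2 K) (a b : ℝ) :
    Measure.hausdorffMeasure 1 (arcLength K '' Ico a b) =
      ENNReal.ofReal (arcLength K b - arcLength K a) := by
  rcases le_or_gt b a with hab | hab
  · rw [Ico_eq_empty (not_lt.2 hab), image_empty, measure_empty, ENNReal.ofReal_of_nonpos]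
    exact sub_nonpos.2 (hK.strictMono_arcLength.monotone hab)
  have : arcLength K '' Ico a b = Ico (arcLength K a) (arcLength K b) := by
    apply subset_antisymm
    · rintro _ ⟨x, hx, rfl⟩
      exact ⟨hK.strictMono_arcLength.monotone hx.1, hK.strictMono_arcLength hx.2⟩
    · exact intermediate_value_Ico hab.le hK.continuous_arcLength.continuousOn
  rw [this, hausdorffMeasure_real, Real.volume_Ico]

theorem hausdorffMeasure_arc_le (hK : IsStrictlyConvexC2 K) (a b : ℝ) :
    Measure.hausdorffMeasure 1 (boundaryPt K '' Ico a b) ≤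
      ENNReal.ofReal (arcLength K b - arcLength K a) := by
  rw [← hK.hausdorffMeasure_arcLength_image]
  simpa using hausdorffMeasure_image_le_image (boundaryPt K) (arcLength K) (Ico a b) 1
    fun x _ y _ => by
      rw [NNReal.coe_one, one_mul]
      rcases le_total x y with h | h
      · rw [dist_comm, dist_comm (arcLength K x), hK.dist_arcLength h]
        exact hK.dist_boundaryPt_le h
      · rw [hK.dist_arcLength h]
        exact hK.dist_boundaryPt_le h

theorem le_hausdorffMeasure_arc (hK : IsStrictlyConvexC2 K) {a h : ℝ} (h' : h < π / 2)
    (h0 : 0 ≤ h) :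
    ENNReal.ofReal (cos h * (arcLength K (a + h) - arcLength K a)) ≤
      Measure.hausdorffMeasure 1 (boundaryPt K '' Ico a (a + h)) := by
  have hcos : 0 < cos h := cos_pos_of_mem_Ioo ⟨by linarith [pi_pos], h'⟩
  have hle := hausdorffMeasure_image_le_image (arcLength K) (boundaryPt K) (Ico a (a + h))
    (cos h)⁻¹.toNNReal fun x hx y hy => by
      rw [Real.coe_toNNReal _ (inv_nonneg.2 hcos.le), inv_mul_eq_div, le_div_iff₀ hcos, mul_comm]
      rcases le_total x y with h1 | h1
      · rw [dist_comm, dist_comm (boundaryPt K x), hK.dist_arcLength h1]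
        exact hK.le_dist_boundaryPt h1 (by linarith [hx.1, hy.2]) (by linarith)
      · rw [hK.dist_arcLength h1]
        exact hK.le_dist_boundaryPt h1 (by linarith [hx.2, hy.1]) (by linarith)
  rw [hK.hausdorffMeasure_arcLength_image] at hle
  rw [ENNReal.ofReal_mul hcos.le]
  calc _ ≤ ENNReal.ofReal (cos h) * (_ * _) := by gcongr
    _ = _ := by
      have : ENNReal.ofReal (cos h) * ((cos h)⁻¹.toNNReal : ENNReal) = 1 := by
        rw [← ENNReal.ofReal, ← ENNReal.ofReal_mul hcos.le, mul_inv_cancel₀ hcos.ne',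
          ENNReal.ofReal_one]
      rw [← mul_assoc, this, one_mul]

theorem measurableSet_arc (hK : IsStrictlyConvexC2 K) {a b : ℝ} (ha : 0 ≤ a) (hb : b ≤ 2 * π) :
    MeasurableSet (boundaryPt K '' Ico a b) :=
  measurableSet_Ico.image_of_continuousOn_injOn hK.continuous_boundaryPt.continuousOn
    (hK.injOn_boundaryPt.mono (Ico_subset_Ico ha hb))

/-- Additivity over n disjoint arcs keeps the single loss factor cos h, which tends to 1 as the arcs
shrink. -/
theorem le_hausdorffMeasure_arcs (hK : IsStrictlyConvexC2 K) {h : ℝ} (h' : h < π / 2)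
    (h0 : 0 ≤ h) (n : ℕ) (hn : n * h ≤ 2 * π) :
    ENNReal.ofReal (cos h * (arcLength K (n * h) - arcLength K 0)) ≤
      Measure.hausdorffMeasure 1 (boundaryPt K '' Ico 0 (n * h)) := by
  have hcos : 0 < cos h := cos_pos_of_mem_Ioo ⟨by linarith [pi_pos], h'⟩
  induction n with
  | zero => simp
  | succ n ih =>
    have hs : ((n + 1 : ℕ) : ℝ) * h = n * h + h := by push_cast; ring
    rw [hs] at hn ⊢
    have hnh : 0 ≤ n * h := by positivity
    have h1 : Ico 0 (n * h + h) = Ico 0 (n * h) ∪ Ico (n * h) (n * h + h) :=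
      (Ico_union_Ico_eq_Ico hnh (by linarith)).symm
    have hdisj : Disjoint (boundaryPt K '' Ico 0 (n * h))
        (boundaryPt K '' Ico (n * h) (n * h + h)) := by
      rw [disjoint_left]
      rintro _ ⟨x, hx, rfl⟩ ⟨y, hy, hxy⟩
      have := hK.injOn_boundaryPt ⟨hnh.trans hy.1, hy.2.trans_le hn⟩
        ⟨hx.1, hx.2.trans_le (by linarith)⟩ hxy
      linarith [hx.2, hy.1]
    rw [h1, image_union, measure_union hdisj (hK.measurableSet_arc hnh hn)]
    have hm := hK.strictMono_arcLength.monotone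
    have e : cos h * (arcLength K (n * h + h) - arcLength K 0) =
        cos h * (arcLength K (n * h) - arcLength K 0) +
        cos h * (arcLength K (n * h + h) - arcLength K (n * h)) := by ring
    rw [e, ENNReal.ofReal_add (mul_nonneg hcos.le (sub_nonneg.2 (hm hnh)))
      (mul_nonneg hcos.le (sub_nonneg.2 (hm (by linarith))))]
    exact add_le_add (ih (by linarith)) (hK.le_hausdorffMeasure_arc h' h0)

theorem length_eq_arcLength (hK : IsStrictlyConvexC2 K) : length K = arcLength K (2 * π) := by
  have hz : arcLength K 0 = 0 := by simp [arcLength]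
  have hpos : 0 ≤ arcLength K (2 * π) := hz ▸ hK.strictMono_arcLength.monotone two_pi_pos.le
  have hup := hK.hausdorffMeasure_arc_le 0 (2 * π)
  rw [hz, sub_zero, ← hK.frontier_eq_image] at hup
  have hlow : ENNReal.ofReal (arcLength K (2 * π)) ≤
      Measure.hausdorffMeasure 1 (frontier K) := by
    have hlim : Tendsto (fun n : ℕ => ENNReal.ofReal
        (cos (2 * π / n) * (arcLength K (2 * π) - arcLength K 0))) atTop
        (𝓝 (ENNReal.ofReal (cos 0 * (arcLength K (2 * π) - arcLength K 0)))) := by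
      refine ENNReal.tendsto_ofReal (Tendsto.mul_const _ ?_)
      exact (continuous_cos.tendsto 0).comp (tendsto_const_div_atTop_nhds_zero_nat _)
    rw [hz, sub_zero, cos_zero, one_mul] at hlim
    refine le_of_tendsto hlim ?_
    -- From n = 5 on, the step 2π/n is smaller than π/2, so its cosine is positive.
    filter_upwards [eventually_ge_atTop 5] with n hn
    have hn' : (5 : ℝ) ≤ n := by exact_mod_cast hn
    have e : (n : ℝ) * (2 * π / n) = 2 * π := by field_simp
    have := hK.le_hausdorffMeasure_arcs (h := 2 * π / n) ?_ (by positivity) n e.le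
    · rwa [e, hz, sub_zero, ← hK.frontier_eq_image] at this
    · rw [div_lt_div_iff₀ (by linarith) two_pos]
      nlinarith [pi_pos]
  rw [length, le_antisymm hup hlow, ENNReal.toReal_ofReal hpos]

/-- Cauchy's formula for the length. -/
theorem length_eq (hK : IsStrictlyConvexC2 K) :
    length K = ∫ φ in (0 : ℝ)..2 * π, supportFn K φ := by
  have hs := hK.isSupport
  rw [hK.length_eq_arcLength, arcLength, integral_add (hs.continuous.intervalIntegrable _ _)
    (hs.continuous_deriv2.intervalIntegrable _ _), integral_eq_sub_of_hasDerivAt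
    (fun x _ => hs.hasDerivAt_deriv x) (hs.continuous_deriv2.intervalIntegrable _ _)]
  have := hs.periodic_deriv 0
  rw [zero_add] at this
  rw [this, sub_self, add_zero]

end IsStrictlyConvexC2

/-! ### Change of variables in the plane and the area of `K`. -/

/-- The coordinate plane `ℝ × ℝ` as a measure space is the Euclidean plane. -/
def planeEquiv : ℝ × ℝ ≃ᵐ Plane :=
  (MeasurableEquiv.finTwoArrow (α := ℝ)).symm.trans (MeasurableEquiv.toLp 2 (Fin 2 → ℝ))

theorem measurePreserving_planeEquiv : MeasurePreserving planeEquiv :=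
  (PiLp.volume_preserving_toLp (Fin 2)).comp (volume_preserving_finTwoArrow ℝ).symm

section ChangeOfVariables

variable {S : Set (ℝ × ℝ)} {u v a b c d : ℝ × ℝ → ℝ}

/-- The linear form with the given coefficients. -/
def linForm (a b : ℝ) : ℝ × ℝ →L[ℝ] ℝ :=
  a • ContinuousLinearMap.fst ℝ ℝ ℝ + b • ContinuousLinearMap.snd ℝ ℝ ℝ

@[simp] theorem linForm_apply (a b : ℝ) (q : ℝ × ℝ) : linForm a b q = a * q.1 + b * q.2 := by
  simp [linForm]

theorem det_linForm_prod (a b c d : ℝ) :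
    ((linForm a b).prod (linForm c d)).det = a * d - b * c := by
  have h : (linForm a b).prod (linForm c d) = (Matrix.toLin (.finTwoProd ℝ) (.finTwoProd ℝ)
      !![a, b; c, d]).toContinuousLinearMap := by
    rw [Matrix.toLin_finTwoProd_toContinuousLinearMap]
    rfl
  rw [h, LinearMap.det_toContinuousLinearMap, LinearMap.det_toLin, Matrix.det_fin_two_of]

theorem injOn_prod_of_plane (hinj : InjOn (fun q => (!₂[u q, v q] : Plane)) S) :
    InjOn (fun q => (u q, v q)) S := fun x hx y hy h => by
  refine hinj hx hy ?_
  simp only [Prod.mk.injEq] at h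
  simp only [h.1, h.2]

/-- Change of variables in the plane. -/
theorem integral_image_plane (hS : MeasurableSet S)
    (hu : ∀ q ∈ S, HasFDerivAt u (linForm (a q) (b q)) q)
    (hv : ∀ q ∈ S, HasFDerivAt v (linForm (c q) (d q)) q)
    (hinj : InjOn (fun q => (!₂[u q, v q] : Plane)) S) (g : Plane → ℝ) :
    ∫ x in (fun q => (!₂[u q, v q] : Plane)) '' S, g x =
      ∫ q in S, |a q * d q - b q * c q| * g !₂[u q, v q] := by
  have him : planeEquiv ⁻¹' ((fun q => (!₂[u q, v q] : Plane)) '' S) =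
      (fun q => (u q, v q)) '' S := by
    rw [← planeEquiv.injective.preimage_image ((fun q => (u q, v q)) '' S), image_image]
    rfl
  rw [← measurePreserving_planeEquiv.setIntegral_preimage_emb planeEquiv.measurableEmbedding, him,
    integral_image_eq_integral_abs_det_fderiv_smul volume hS
      (fun q hq => ((hu q hq).prodMk (hv q hq)).hasFDerivWithinAt) (injOn_prod_of_plane hinj)]
  simp only [det_linForm_prod, smul_eq_mul]
  rfl

theorem integrableOn_image_plane (hS : MeasurableSet S)
    (hu : ∀ q ∈ S, HasFDerivAt u (linForm (a q) (b q)) q)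
    (hv : ∀ q ∈ S, HasFDerivAt v (linForm (c q) (d q)) q)
    (hinj : InjOn (fun q => (!₂[u q, v q] : Plane)) S) (g : Plane → ℝ) :
    IntegrableOn g ((fun q => (!₂[u q, v q] : Plane)) '' S) ↔
      IntegrableOn (fun q => |a q * d q - b q * c q| * g !₂[u q, v q]) S := by
  have him : planeEquiv ⁻¹' ((fun q => (!₂[u q, v q] : Plane)) '' S) =
      (fun q => (u q, v q)) '' S := by
    rw [← planeEquiv.injective.preimage_image ((fun q => (u q, v q)) '' S), image_image]
    rfl
  rw [← measurePreserving_planeEquiv.integrableOn_comp_preimage planeEquiv.measurableEmbedding,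
    him, integrableOn_image_iff_integrableOn_abs_det_fderiv_smul volume hS
      (fun q hq => ((hu q hq).prodMk (hv q hq)).hasFDerivWithinAt) (injOn_prod_of_plane hinj)]
  simp only [det_linForm_prod, smul_eq_mul]
  rfl

end ChangeOfVariables

namespace IsStrictlyConvexC2

variable {K : Set Plane}

theorem boundaryPt_apply_zero (K : Set Plane) (φ : ℝ) : boundaryPt K φ 0 =
    supportFn K φ * cos φ - deriv (supportFn K) φ * sin φ := by
  simp [boundaryPt, N, N']; ring

theorem boundaryPt_apply_one (K : Set Plane) (φ : ℝ) : boundaryPt K φ 1 =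
    supportFn K φ * sin φ + deriv (supportFn K) φ * cos φ := by
  simp [boundaryPt, N, N']

theorem hasDerivAt_boundaryPt_zero (hK : IsStrictlyConvexC2 K) (φ : ℝ) :
    HasDerivAt (fun φ => boundaryPt K φ 0)
      (-((supportFn K φ + deriv (deriv (supportFn K)) φ) * sin φ)) φ := by
  simp only [boundaryPt_apply_zero]
  convert! ((hK.isSupport.hasDerivAt φ).mul (hasDerivAt_cos φ)).sub
    ((hK.isSupport.hasDerivAt_deriv φ).mul (hasDerivAt_sin φ)) using 1
  ring

theorem hasDerivAt_boundaryPt_one (hK : IsStrictlyConvexC2 K) (φ : ℝ) :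
    HasDerivAt (fun φ => boundaryPt K φ 1)
      ((supportFn K φ + deriv (deriv (supportFn K)) φ) * cos φ) φ := by
  simp only [boundaryPt_apply_one]
  convert! ((hK.isSupport.hasDerivAt φ).mul (hasDerivAt_sin φ)).add
    ((hK.isSupport.hasDerivAt_deriv φ).mul (hasDerivAt_cos φ)) using 1
  ring

/-- The midpoint of the points of contact of two parallel support lines. -/
def interiorPt (K : Set Plane) : Plane := (1 / 2 : ℝ) • (boundaryPt K 0 + boundaryPt K π)

/-- Equality would make γ(0) and γ(π) both touch the support line of direction φ, forcing φ to agree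
with 0 and with π modulo 2π. -/
theorem inner_interiorPt_lt (hK : IsStrictlyConvexC2 K) (φ : ℝ) :
    inner ℝ (interiorPt K) (N φ) < supportFn K φ := by
  rw [interiorPt, real_inner_smul_left, inner_add_left]
  have h1 := hK.inner_le (hK.boundaryPt_mem 0) φ
  have h2 := hK.inner_le (hK.boundaryPt_mem π) φ
  rcases h1.lt_or_eq with h1' | h1'
  · linarith
  rcases h2.lt_or_eq with h2' | h2'
  · linarith
  exfalso
  obtain ⟨k, hk⟩ := hK.inner_boundaryPt_eq_iff.1 h1'
  obtain ⟨l, hl⟩ := hK.inner_boundaryPt_eq_iff.1 h2'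
  have hkl := eq_of_eq_add_int_mul (φ := 0) (ψ := π) (k := k - l)
    ⟨le_rfl, two_pi_pos⟩ ⟨pi_pos.le, by linarith [pi_pos]⟩ (by push_cast; linarith)
  exact pi_ne_zero hkl

/-- The parametrization of `K` by the segments from an interior point to the boundary. -/
def starParam (K : Set Plane) (q : ℝ × ℝ) : Plane :=
  interiorPt K + q.1 • (boundaryPt K q.2 - interiorPt K)

theorem inner_starParam (K : Set Plane) (q : ℝ × ℝ) (ψ : ℝ) :
    inner ℝ (starParam K q) (N ψ) = inner ℝ (interiorPt K) (N ψ) +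
      q.1 * (inner ℝ (boundaryPt K q.2) (N ψ) - inner ℝ (interiorPt K) (N ψ)) := by
  rw [starParam, inner_add_left, real_inner_smul_left, inner_sub_left]

theorem injOn_starParam (hK : IsStrictlyConvexC2 K) :
    InjOn (starParam K) (Ioc 0 1 ×ˢ Ico 0 (2 * π)) := by
  -- Measured from the centre in direction ψ, the point γ(ψ) is farthest; so a common image point
  -- needs a parameter on the ray to γ(φ) at least as large as on the ray to γ(ψ).
  have key : ∀ s t φ ψ : ℝ, 0 < s → starParam K (s, φ) = starParam K (t, ψ) → t ≤ s := by
    intro s t φ ψ hs h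
    have h1 := inner_starParam K (s, φ) ψ
    rw [h, inner_starParam, inner_boundaryPt_self] at h1
    have h2 := hK.inner_le (hK.boundaryPt_mem φ) ψ
    have h3 := hK.inner_interiorPt_lt ψ
    simp only at h1
    nlinarith
  rintro ⟨s, φ⟩ ⟨hs, hφ⟩ ⟨t, ψ⟩ ⟨ht, hψ⟩ h
  have hst : s = t := le_antisymm (key t s ψ φ ht.1 h.symm) (key s t φ ψ hs.1 h)
  subst hst
  have h1 := inner_starParam K (s, φ) ψ
  rw [h, inner_starParam, inner_boundaryPt_self] at h1
  obtain ⟨k, hk⟩ := hK.inner_boundaryPt_eq_iff (φ := φ) (ψ := ψ) |>.1 (by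
    have := mul_left_cancel₀ hs.1.ne' (add_left_cancel h1)
    simp only at this
    linarith)
  exact congrArg (Prod.mk s) (eq_of_eq_add_int_mul hφ hψ hk).symm

theorem starParam_image (hK : IsStrictlyConvexC2 K) :
    starParam K '' (Ioc 0 1 ×ˢ Ico 0 (2 * π)) = K \ {interiorPt K} := by
  ext P
  constructor
  · rintro ⟨⟨s, φ⟩, ⟨hs, hφ⟩, rfl⟩
    refine ⟨hK.mem_iff.2 fun ψ => ?_, fun h => ?_⟩
    · rw [inner_starParam]
      have h2 := hK.inner_le (hK.boundaryPt_mem φ) ψ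
      have h3 := hK.inner_interiorPt_lt ψ
      simp only at hs ⊢
      nlinarith [hs.1, hs.2, mul_le_mul_of_nonneg_left h2 hs.1.le]
    · have h1 := inner_starParam K (s, φ) φ
      have h3 := hK.inner_interiorPt_lt φ
      rw [mem_singleton_iff.1 h, inner_boundaryPt_self] at h1
      simp only at h1 hs
      nlinarith [hs.1]
  · rintro ⟨hP, hne⟩
    rw [mem_singleton_iff] at hne
    have hne' : P - interiorPt K ≠ 0 := sub_ne_zero.2 hne
    set ray : ℝ → Plane := fun r => interiorPt K + r • (P - interiorPt K) with hray
    have hrayc : Continuous ray := by fun_prop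
    have hcl : IsClosed (ray ⁻¹' K) := hK.isCompact.isClosed.preimage hrayc
    have h1 : (1 : ℝ) ∈ ray ⁻¹' K := by simpa [hray] using hP
    obtain ⟨C, hC⟩ := hK.isCompact.isBounded.exists_norm_le
    have hbdd : BddAbove (ray ⁻¹' K) := by
      refine ⟨(C + ‖interiorPt K‖) / ‖P - interiorPt K‖, fun r hr => ?_⟩
      rw [le_div_iff₀ (norm_pos_iff.2 hne')]
      have h2 : ‖r • (P - interiorPt K)‖ ≤ C + ‖interiorPt K‖ := by
        have : r • (P - interiorPt K) = ray r - interiorPt K := by simp [hray]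
        rw [this]
        exact (norm_sub_le _ _).trans (by gcongr; exact hC _ hr)
      rw [norm_smul, Real.norm_eq_abs] at h2
      exact (mul_le_mul_of_nonneg_right (le_abs_self r) (norm_nonneg _)).trans h2
    have hmem : sSup (ray ⁻¹' K) ∈ ray ⁻¹' K := hcl.csSup_mem ⟨1, h1⟩ hbdd
    -- The ray from the centre through P leaves `K` at parameter r, where it meets the boundary; P
    -- itself has star parameter 1/r.
    set r := sSup (ray ⁻¹' K) with hr
    have hr1 : 1 ≤ r := le_csSup hbdd h1
    have hfr : ray r ∈ frontier K := by
      rw [hK.isCompact.isClosed.frontier_eq]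
      refine ⟨hmem, fun hint => ?_⟩
      obtain ⟨ε, hε, hb⟩ := Metric.eventually_nhds_iff.1
        (hrayc.continuousAt (mem_interior_iff_mem_nhds.1 hint) : ∀ᶠ t in 𝓝 r, ray t ∈ K)
      have := le_csSup hbdd (hb (y := r + ε / 2) (by
        rw [Real.dist_eq, add_sub_cancel_left, abs_of_pos (by positivity)]; linarith) :
          r + ε / 2 ∈ ray ⁻¹' K)
      linarith
    rw [hK.frontier_eq_image] at hfr
    obtain ⟨φ, hφ, he⟩ := hfr
    have hr0 : 0 < r := by linarith
    refine ⟨(r⁻¹, φ), ⟨⟨by positivity, inv_le_one_of_one_le₀ hr1⟩, hφ⟩, ?_⟩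
    simp only [starParam, he, hray, add_sub_cancel_left]
    rw [smul_smul, inv_mul_cancel₀ hr0.ne', one_smul, add_sub_cancel]

theorem area_eq_integral (hK : IsStrictlyConvexC2 K) :
    area K = ∫ q in Ioc (0 : ℝ) 1 ×ˢ Ico (0 : ℝ) (2 * π), q.1 *
      ((supportFn K q.2 - inner ℝ (interiorPt K) (N q.2)) *
        (supportFn K q.2 + deriv (deriv (supportFn K)) q.2)) := by
  have hu : ∀ q ∈ Ioc (0 : ℝ) 1 ×ˢ Ico (0 : ℝ) (2 * π), HasFDerivAt
      (fun q : ℝ × ℝ => interiorPt K 0 + q.1 * (boundaryPt K q.2 0 - interiorPt K 0))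
      (linForm (boundaryPt K q.2 0 - interiorPt K 0)
        (q.1 * -((supportFn K q.2 + deriv (deriv (supportFn K)) q.2) * sin q.2))) q := by
    intro q _
    refine ((hasFDerivAt_fst.mul (((hK.hasDerivAt_boundaryPt_zero q.2).comp_hasFDerivAt q
      hasFDerivAt_snd).sub_const (interiorPt K 0))).const_add (interiorPt K 0)).congr_fderiv ?_
    ext <;> simp
  have hv : ∀ q ∈ Ioc (0 : ℝ) 1 ×ˢ Ico (0 : ℝ) (2 * π), HasFDerivAt
      (fun q : ℝ × ℝ => interiorPt K 1 + q.1 * (boundaryPt K q.2 1 - interiorPt K 1))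
      (linForm (boundaryPt K q.2 1 - interiorPt K 1)
        (q.1 * ((supportFn K q.2 + deriv (deriv (supportFn K)) q.2) * cos q.2))) q := by
    intro q _
    refine ((hasFDerivAt_fst.mul (((hK.hasDerivAt_boundaryPt_one q.2).comp_hasFDerivAt q
      hasFDerivAt_snd).sub_const (interiorPt K 1))).const_add (interiorPt K 1)).congr_fderiv ?_
    ext <;> simp
  have hF : (fun q : ℝ × ℝ => (!₂[interiorPt K 0 + q.1 * (boundaryPt K q.2 0 - interiorPt K 0),
      interiorPt K 1 + q.1 * (boundaryPt K q.2 1 - interiorPt K 1)] : Plane)) = starParam K := by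
    ext q i
    fin_cases i <;> simp [starParam]
  have h := integral_image_plane (measurableSet_Ioc.prod measurableSet_Ico) hu hv
    (by rw [hF]; exact hK.injOn_starParam) (fun _ => 1)
  rw [hF, hK.starParam_image, setIntegral_const, smul_eq_mul, mul_one, measureReal_def,
    measure_sdiff_null (measure_singleton _)] at h
  rw [area, h]
  refine setIntegral_congr_fun (measurableSet_Ioc.prod measurableSet_Ico) fun q hq => ?_
  have h2 : (inner ℝ (boundaryPt K q.2 - interiorPt K) (N q.2) : ℝ) =
      supportFn K q.2 - inner ℝ (interiorPt K) (N q.2) := by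
    rw [inner_sub_left, inner_boundaryPt_self]
  have h3 := hK.inner_interiorPt_lt q.2
  have h4 := hK.radius_pos q.2
  have h5 : 0 < q.1 := hq.1.1
  have h6 : 0 < q.1 * ((supportFn K q.2 - inner ℝ (interiorPt K) (N q.2)) *
        (supportFn K q.2 + deriv (deriv (supportFn K)) q.2)) :=
    mul_pos h5 (mul_pos (sub_pos.2 h3) h4)
  simp only [mul_one]
  rw [← abs_of_pos h6, ← h2, inner_N]
  congr 1
  simp
  ring

/-- The area in terms of the support function. -/
theorem area_eq (hK : IsStrictlyConvexC2 K) :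
    area K = (1 / 2) * ∫ φ in (0 : ℝ)..2 * π, (supportFn K φ ^ 2 - deriv (supportFn K) φ ^ 2) := by
  have hs := hK.isSupport
  have h0 := hs.continuous
  have h1 := hs.continuous_deriv
  have h2 := hs.continuous_deriv2
  set c := interiorPt K
  have hN : Continuous fun φ => (inner ℝ c (N φ) : ℝ) := by simp only [inner_N]; fun_prop
  have hN' : Continuous fun φ => (inner ℝ c (N' φ) : ℝ) := by simp only [inner_N']; fun_prop
  rw [hK.area_eq_integral, Measure.volume_eq_prod,
    setIntegral_prod_mul (fun s : ℝ => s) (fun φ => (supportFn K φ - inner ℝ c (N φ)) *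
        (supportFn K φ + deriv (deriv (supportFn K)) φ)),
    ← integral_of_le zero_le_one, integral_Ico_eq_integral_Ioc, ← integral_of_le two_pi_pos.le,
    integral_id]
  -- The star integrand differs from p² - p'² by the derivative of a periodic function, so the
  -- choice of centre drops out. The factor 1/2 is the integral of s over [0, 1].
  have key : ∀ φ ∈ uIcc 0 (2 * π), HasDerivAt
      (fun φ => supportFn K φ * deriv (supportFn K) φ - (inner ℝ c (N φ) * deriv (supportFn K) φ
        - inner ℝ c (N' φ) * supportFn K φ))
      ((supportFn K φ - inner ℝ c (N φ)) * (supportFn K φ + deriv (deriv (supportFn K)) φ) -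
        (supportFn K φ ^ 2 - deriv (supportFn K) φ ^ 2)) φ := fun φ _ => by
    convert! ((hs.hasDerivAt φ).mul (hs.hasDerivAt_deriv φ)).sub
      (((hasDerivAt_inner_N c φ).mul (hs.hasDerivAt_deriv φ)).sub
        ((hasDerivAt_inner_N' c φ).mul (hs.hasDerivAt φ))) using 1
    ring
  have hint := integral_eq_sub_of_hasDerivAt key
    (Continuous.intervalIntegrable (by fun_prop) _ _)
  have e0 := hs.periodic 0
  have e1 := hs.periodic_deriv 0
  have e2 := N_add_int_mul 0 1
  have e3 := N'_add_int_mul 0 1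
  rw [zero_add] at e0 e1
  rw [Int.cast_one, one_mul, zero_add] at e2 e3
  rw [e0, e1, e2, e3, sub_self, intervalIntegral.integral_sub
    (Continuous.intervalIntegrable (by fun_prop) _ _)
    (Continuous.intervalIntegrable (by fun_prop) _ _), sub_eq_zero] at hint
  rw [hint]
  norm_num

end IsStrictlyConvexC2

/-! ### Exterior points in the coordinates of their two tangents. -/

/-- The length of the tangent from `γ(φ)` to the support line of direction `φ + τ`. -/
def tangentLen (p : ℝ → ℝ) (φ τ : ℝ) : ℝ := leadGap p φ τ / sin τ

/-- The density of the area measure in the directions of the two tangents. -/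
def exteriorDensity (p : ℝ → ℝ) (q : ℝ × ℝ) : ℝ :=
  leadGap p q.1 q.2 * trailGap p q.1 q.2 / sin q.2 ^ 3

/-- The intersection of the support lines of directions `φ` and `φ + τ`. -/
def exteriorParam (K : Set Plane) (q : ℝ × ℝ) : Plane :=
  boundaryPt K q.1 + tangentLen (supportFn K) q.1 q.2 • N' q.1

/-- The τ-derivative of the tangent length T is the trailing gap over sin² τ, so the exterior
density is the τ-derivative of T²/2. Crofton's formula rests on integrating this by parts. -/
theorem IsSupport.hasFDerivAt_tangentLen {p : ℝ → ℝ} (hp : IsSupport p) {q : ℝ × ℝ}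
    (hq : sin q.2 ≠ 0) :
    HasFDerivAt (fun q : ℝ × ℝ => tangentLen p q.1 q.2)
      (linForm ((deriv p (q.1 + q.2) - deriv p q.1 * cos q.2 - deriv (deriv p) q.1 * sin q.2) /
        sin q.2) (trailGap p q.1 q.2 / sin q.2 ^ 2)) q := by
  have hadd : HasFDerivAt (fun q : ℝ × ℝ => q.1 + q.2)
      (ContinuousLinearMap.fst ℝ ℝ ℝ + ContinuousLinearMap.snd ℝ ℝ ℝ) q :=
    hasFDerivAt_fst.add hasFDerivAt_snd
  have hsum := (hp.hasDerivAt (q.1 + q.2)).comp_hasFDerivAt q hadd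
  have hfst : HasFDerivAt (fun q : ℝ × ℝ => q.1) (ContinuousLinearMap.fst ℝ ℝ ℝ) q :=
    hasFDerivAt_fst
  have hsnd : HasFDerivAt (fun q : ℝ × ℝ => q.2) (ContinuousLinearMap.snd ℝ ℝ ℝ) q :=
    hasFDerivAt_snd
  have h1 := (hp.hasDerivAt q.1).comp_hasFDerivAt q hfst
  have h2 := (hp.hasDerivAt_deriv q.1).comp_hasFDerivAt q hfst
  have hc := (hasDerivAt_cos q.2).comp_hasFDerivAt q hsnd
  have hs := (hasDerivAt_sin q.2).comp_hasFDerivAt q hsnd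
  have hinv := (hasDerivAt_inv hq).comp_hasFDerivAt q hs
  have h := ((hsum.sub (h1.mul hc)).sub (h2.mul hs)).mul hinv
  have hsc := sin_sq_add_cos_sq q.2
  refine HasFDerivAt.congr_fderiv (HasFDerivAt.congr_of_eventuallyEq h ?_) ?_
  · exact Eventually.of_forall fun q => by simp [tangentLen, leadGap, div_eq_mul_inv]
  · ext
    · simp
      field_simp
    · simp [trailGap]
      field_simp
      linear_combination (p q.1) * hsc

namespace IsStrictlyConvexC2

variable {K : Set Plane}

theorem supportFrom_exteriorParam (K : Set Plane) {φ τ : ℝ} (h : sin τ ≠ 0) :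
    supportFrom K (exteriorParam K (φ, τ)) φ = 0 ∧
      supportFrom K (exteriorParam K (φ, τ)) (φ + τ) = 0 := by
  have hsc := sin_sq_add_cos_sq φ
  have e1 : (inner ℝ (N' φ) (N φ) : ℝ) = 0 := by rw [inner_N]; simp [N']; ring
  have e2 : (inner ℝ (N' φ) (N (φ + τ)) : ℝ) = sin τ := by
    rw [inner_N]
    simp [N', cos_add, sin_add]
    linear_combination (sin τ) * hsc
  constructor
  · rw [supportFrom, exteriorParam, inner_add_left, real_inner_smul_left, inner_boundaryPt_self, e1]
    ring
  · rw [supportFrom, exteriorParam, inner_add_left, real_inner_smul_left, inner_boundaryPt, e2,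
      tangentLen]
    field_simp
    ring

theorem eq_exteriorParam (hK : IsStrictlyConvexC2 K) {P : Plane} {φ τ : ℝ} (h : sin τ ≠ 0)
    (h0 : supportFrom K P φ = 0) (h1 : supportFrom K P (φ + τ) = 0) :
    P = exteriorParam K (φ, τ) := by
  have e := hK.boundaryPt_sub h0
  have hd : deriv (supportFrom K P) φ * sin τ = -leadGap (supportFn K) φ τ := by
    have h2 : (inner ℝ (boundaryPt K φ - P) (N (φ + τ)) : ℝ) =
        deriv (supportFrom K P) φ * sin τ := by
      have hsc := sin_sq_add_cos_sq φ
      rw [e, real_inner_smul_left, inner_N]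
      simp [N', cos_add, sin_add]
      left
      linear_combination (sin τ) * hsc
    rw [← h2, inner_sub_left, inner_boundaryPt]
    unfold supportFrom at h1
    linarith
  have hT : tangentLen (supportFn K) φ τ = -deriv (supportFrom K P) φ := by
    rw [tangentLen]; field_simp; linarith
  simp only [exteriorParam, hT]
  rw [neg_smul, ← e]
  abel

theorem injOn_exteriorParam (hK : IsStrictlyConvexC2 K) :
    InjOn (exteriorParam K) (Ico 0 (2 * π) ×ˢ Ioo 0 π) := by
  rintro ⟨φ, τ⟩ ⟨hφ, hτ⟩ ⟨φ', τ'⟩ ⟨hφ', hτ'⟩ h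
  have h1 := supportFrom_exteriorParam K (φ := φ) (sin_pos_of_mem_Ioo hτ).ne'
  have h2 := supportFrom_exteriorParam K (φ := φ') (sin_pos_of_mem_Ioo hτ').ne'
  rw [← h] at h2
  obtain ⟨⟨k, hk⟩, ht⟩ := (hK.isSupport_from _).zero_pair_unique hτ.1 hτ.2 h1.1 h1.2
    hτ'.1 hτ'.2 h2.1 h2.2
  exact Prod.ext (eq_of_eq_add_int_mul hφ hφ' hk).symm ht.symm

theorem exteriorParam_image (hK : IsStrictlyConvexC2 K) :
    exteriorParam K '' (Ico 0 (2 * π) ×ˢ Ioo 0 π) = Kᶜ := by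
  ext P
  rw [mem_compl_iff, hK.notMem_iff]
  constructor
  · rintro ⟨⟨φ, τ⟩, ⟨-, hτ⟩, rfl⟩
    have h1 := supportFrom_exteriorParam K (φ := φ) (sin_pos_of_mem_Ioo hτ).ne'
    exact (hK.isSupport_from _).exists_neg_of_zeros hτ.1 hτ.2 h1.1 h1.2
  · rintro ⟨ψ, hψ⟩
    obtain ⟨φ, τ, hτ, hτ', h0, h1⟩ := (hK.isSupport_from P).exists_zeros_of_neg hψ
    obtain ⟨χ, hχ, k, hk⟩ := exists_eq_add_of_angle 0 φ
    rw [zero_add] at hk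
    have hper := (hK.isSupport_from P).periodic.int_mul k
    rw [hk, hper] at h0
    rw [hk, add_right_comm, hper] at h1
    exact ⟨(χ, τ), ⟨hχ, hτ, hτ'⟩,
      (hK.eq_exteriorParam (sin_pos_of_pos_of_lt_pi hτ hτ').ne' h0 h1).symm⟩

theorem visualAngle_exteriorParam (hK : IsStrictlyConvexC2 K) (φ : ℝ) {τ : ℝ}
    (hτ : τ ∈ Ioo 0 π) : visualAngle K (exteriorParam K (φ, τ)) = π - τ := by
  have h1 := supportFrom_exteriorParam K (φ := φ) (sin_pos_of_mem_Ioo hτ).ne'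
  exact hK.visualAngle_eq hτ.1 hτ.2 h1.1 h1.2

/-- In the frame (N, N') at φ, the τ-derivative of the parametrization is T_τ N' and the
φ-derivative has normal component -T. The Jacobian is therefore T T_τ up to sign, and the
φ-derivative of T cancels. -/
theorem integral_exterior (hK : IsStrictlyConvexC2 K) (g : ℝ → ℝ) :
    (IntegrableOn (fun P => g (visualAngle K P)) Kᶜ ↔
      IntegrableOn (fun q => exteriorDensity (supportFn K) q * g (π - q.2))
        (Ico 0 (2 * π) ×ˢ Ioo 0 π)) ∧
    ∫ P in Kᶜ, g (visualAngle K P) = ∫ q in Ico (0 : ℝ) (2 * π) ×ˢ Ioo (0 : ℝ) π,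
      exteriorDensity (supportFn K) q * g (π - q.2) := by
  have hs := hK.isSupport
  set p := supportFn K with hp
  have hmeas : MeasurableSet (Ico (0 : ℝ) (2 * π) ×ˢ Ioo (0 : ℝ) π) :=
    measurableSet_Ico.prod measurableSet_Ioo
  have hsin : ∀ q ∈ Ico (0 : ℝ) (2 * π) ×ˢ Ioo (0 : ℝ) π, 0 < sin q.2 := fun q hq =>
    sin_pos_of_mem_Ioo hq.2
  set T : ℝ × ℝ → ℝ := fun q => tangentLen p q.1 q.2 with hT
  set Tφ : ℝ × ℝ → ℝ := fun q =>
    (deriv p (q.1 + q.2) - deriv p q.1 * cos q.2 - deriv (deriv p) q.1 * sin q.2) / sin q.2 with hTφ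
  set Tτ : ℝ × ℝ → ℝ := fun q => trailGap p q.1 q.2 / sin q.2 ^ 2 with hTτ
  set ρ : ℝ × ℝ → ℝ := fun q => p q.1 + deriv (deriv p) q.1 with hρ
  have hdT : ∀ q ∈ Ico (0 : ℝ) (2 * π) ×ˢ Ioo (0 : ℝ) π,
      HasFDerivAt T (linForm (Tφ q) (Tτ q)) q := fun q hq =>
    hs.hasFDerivAt_tangentLen (hsin q hq).ne'
  have hu : ∀ q ∈ Ico (0 : ℝ) (2 * π) ×ˢ Ioo (0 : ℝ) π, HasFDerivAt
      (fun q : ℝ × ℝ => boundaryPt K q.1 0 + T q * -sin q.1)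
      (linForm (-(ρ q * sin q.1) - Tφ q * sin q.1 - T q * cos q.1) (-Tτ q * sin q.1)) q := by
    intro q hq
    refine (((hK.hasDerivAt_boundaryPt_zero q.1).comp_hasFDerivAt q hasFDerivAt_fst).add
      ((hdT q hq).mul ((hasDerivAt_sin q.1).comp_hasFDerivAt q hasFDerivAt_fst).neg)).congr_fderiv
        ?_
    ext
    · simp [hρ]; ring
    · simp; ring
  have hv : ∀ q ∈ Ico (0 : ℝ) (2 * π) ×ˢ Ioo (0 : ℝ) π, HasFDerivAt
      (fun q : ℝ × ℝ => boundaryPt K q.1 1 + T q * cos q.1)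
      (linForm (ρ q * cos q.1 + Tφ q * cos q.1 - T q * sin q.1) (Tτ q * cos q.1)) q := by
    intro q hq
    refine (((hK.hasDerivAt_boundaryPt_one q.1).comp_hasFDerivAt q hasFDerivAt_fst).add
      ((hdT q hq).mul ((hasDerivAt_cos q.1).comp_hasFDerivAt q hasFDerivAt_fst))).congr_fderiv ?_
    ext
    · simp [hρ]; ring
    · simp; ring
  have hF : (fun q : ℝ × ℝ => (!₂[boundaryPt K q.1 0 + T q * -sin q.1,
      boundaryPt K q.1 1 + T q * cos q.1] : Plane)) = exteriorParam K := by
    ext q i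
    fin_cases i <;> simp [exteriorParam, N', hT, hp]
  have hinj := hK.injOn_exteriorParam
  have hdet : EqOn (fun q => |(-(ρ q * sin q.1) - Tφ q * sin q.1 - T q * cos q.1) *
      (Tτ q * cos q.1) - (-Tτ q * sin q.1) *
        (ρ q * cos q.1 + Tφ q * cos q.1 - T q * sin q.1)| *
          g (visualAngle K !₂[boundaryPt K q.1 0 + T q * -sin q.1,
            boundaryPt K q.1 1 + T q * cos q.1]))
      (fun q => exteriorDensity p q * g (π - q.2)) (Ico 0 (2 * π) ×ˢ Ioo 0 π) := by
    intro q hq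
    have h0 := hsin q hq
    have hang : visualAngle K !₂[boundaryPt K q.1 0 + T q * -sin q.1,
            boundaryPt K q.1 1 + T q * cos q.1] = π - q.2 := by
      rw [congrFun hF q]
      exact hK.visualAngle_exteriorParam q.1 hq.2
    simp only [hang]
    congr 1
    have hpos : 0 < exteriorDensity p q := by
      have h1 := hs.leadGap_pos q.1 hq.2.1 hq.2.2.le
      have h2 := hs.trailGap_pos q.1 hq.2.1 hq.2.2.le
      unfold exteriorDensity
      positivity
    rw [← abs_of_pos hpos, ← abs_neg]
    congr 1
    have hsc := sin_sq_add_cos_sq q.1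
    have hTT : exteriorDensity p q = T q * Tτ q := by
      simp only [exteriorDensity, hT, hTτ, tangentLen]
      field_simp
    rw [hTT]
    linear_combination (T q * Tτ q) * hsc
  rw [← hF] at hinj
  have h1 := integrableOn_image_plane hmeas hu hv hinj (fun P => g (visualAngle K P))
  have h2 := integral_image_plane hmeas hu hv hinj (fun P => g (visualAngle K P))
  rw [hF, hK.exteriorParam_image] at h1 h2
  rw [h1, h2]
  exact ⟨integrableOn_congr_fun hdet hmeas, setIntegral_congr_fun hmeas hdet⟩

end IsStrictlyConvexC2

/-! ### Autocorrelations of the support function. -/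

/-- The correlation of two functions over a period. -/
def corr (u v : ℝ → ℝ) (τ : ℝ) : ℝ := ∫ φ in (0 : ℝ)..2 * π, u φ * v (φ + τ)

theorem hasDerivAt_corr {u v v' : ℝ → ℝ} (hu : Continuous u) (hv' : Continuous v')
    (hd : ∀ x, HasDerivAt v (v' x) x) (τ : ℝ) : HasDerivAt (corr u v) (corr u v' τ) τ := by
  have hv : Continuous v := continuous_iff_continuousAt.2 fun x => (hd x).continuousAt
  obtain ⟨C, hC⟩ := (isCompact_Icc (a := τ - 1) (b := τ + 1 + 2 * π)).exists_bound_of_continuousOn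
    hv'.continuousOn
  refine (hasDerivAt_integral_of_dominated_loc_of_deriv_le (F := fun τ φ => u φ * v (φ + τ))
    (F' := fun τ φ => u φ * v' (φ + τ)) (bound := fun φ => |u φ| * C)
    (Metric.ball_mem_nhds τ one_pos)
    (Eventually.of_forall fun x => (Continuous.aestronglyMeasurable (by fun_prop)))
    (Continuous.intervalIntegrable (by fun_prop) _ _)
    (Continuous.aestronglyMeasurable (by fun_prop)) (Eventually.of_forall fun t ht x hx => ?_)
    (Continuous.intervalIntegrable (by fun_prop) _ _)
    (Eventually.of_forall fun t _ x _ => ((hd (t + x)).comp_const_add t x).const_mul (u t))).2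
  rw [uIoc_of_le two_pi_pos.le] at ht
  rw [Metric.mem_ball, Real.dist_eq, abs_lt] at hx
  rw [norm_mul, Real.norm_eq_abs]
  exact mul_le_mul_of_nonneg_left (hC _ ⟨by linarith [ht.1, hx.1], by linarith [ht.2, hx.2]⟩)
    (abs_nonneg _)

theorem continuous_corr {u v : ℝ → ℝ} (hu : Continuous u) (hv : Continuous v) :
    Continuous (corr u v) :=
  continuous_parametric_intervalIntegral_of_continuous' (by fun_prop) _ _

theorem corr_add_two_pi {u v : ℝ → ℝ} (hv : Function.Periodic v (2 * π)) (τ : ℝ) :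
    corr u v (τ + 2 * π) = corr u v τ := by
  simp only [corr, ← add_assoc, hv _]

theorem integral_shift {u : ℝ → ℝ} (hu : Function.Periodic u (2 * π)) (τ : ℝ) :
    ∫ φ in (0 : ℝ)..2 * π, u (φ + τ) = ∫ φ in (0 : ℝ)..2 * π, u φ := by
  rw [integral_comp_add_right]
  have := hu.intervalIntegral_add_eq (0 + τ) 0
  rw [zero_add, zero_add] at this
  rw [zero_add, add_comm (2 * π), this]

theorem corr_neg {u v : ℝ → ℝ} (hu : Function.Periodic u (2 * π))
    (hv : Function.Periodic v (2 * π)) (τ : ℝ) : corr u v (-τ) = corr v u τ := by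
  have h : Function.Periodic (fun φ => v φ * u (φ + τ)) (2 * π) := fun φ => by
    simp only [add_right_comm φ (2 * π) τ, hv _, hu _]
  rw [corr, corr, ← integral_shift h (-τ)]
  simp only [neg_add_cancel_right, mul_comm]

/-- Integrating an autocorrelation against a weight gives a double integral. -/
theorem integral_corr_mul {u v w : ℝ → ℝ} (hu : Continuous u) (hv : Continuous v)
    (hw : Continuous w) (hvp : Function.Periodic v (2 * π)) (hwp : Function.Periodic w (2 * π)) :
    ∫ τ in (0 : ℝ)..2 * π, corr u v τ * w τ =
      ∫ φ in (0 : ℝ)..2 * π, u φ * ∫ ψ in (0 : ℝ)..2 * π, v ψ * w (ψ - φ) := by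
  have h1 : ∀ τ, corr u v τ * w τ = ∫ φ in (0 : ℝ)..2 * π, u φ * v (φ + τ) * w τ := fun τ => by
    rw [corr, intervalIntegral.integral_mul_const]
  simp only [h1]
  rw [intervalIntegral_intervalIntegral_swap]
  · refine integral_congr fun φ _ => ?_
    simp only [mul_assoc]
    rw [intervalIntegral.integral_const_mul]
    congr 1
    have h : Function.Periodic (fun ψ => v ψ * w (ψ - φ)) (2 * π) := fun ψ => by
      simp only [add_sub_right_comm ψ (2 * π) φ, hvp _, hwp _]
    rw [← integral_shift h φ]
    simp only [add_sub_cancel_right, add_comm φ]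
  · rw [uIoc_of_le two_pi_pos.le]
    refine (Continuous.continuousOn (by fun_prop)).integrableOn_compact
      (isCompact_Icc.prod isCompact_Icc) |>.mono_set
        (prod_mono Ioc_subset_Icc_self Ioc_subset_Icc_self)

namespace IsSupport

variable {p : ℝ → ℝ}

theorem hasDerivAt_corr_self (hp : IsSupport p) (τ : ℝ) :
    HasDerivAt (corr p p) (corr p (deriv p) τ) τ :=
  hasDerivAt_corr hp.continuous hp.continuous_deriv hp.hasDerivAt τ

theorem hasDerivAt_corr_deriv (hp : IsSupport p) (τ : ℝ) :
    HasDerivAt (corr p (deriv p)) (corr p (deriv (deriv p)) τ) τ :=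
  hasDerivAt_corr hp.continuous hp.continuous_deriv2 hp.hasDerivAt_deriv τ

/-- The integral of the derivative of a periodic function over a period vanishes. -/
theorem integral_deriv_eq_zero {f f' : ℝ → ℝ} (hd : ∀ x, HasDerivAt f (f' x) x)
    (hf' : Continuous f') (h : Function.Periodic f (2 * π)) :
    ∫ φ in (0 : ℝ)..2 * π, f' φ = 0 := by
  rw [integral_eq_sub_of_hasDerivAt (fun x _ => hd x) (hf'.intervalIntegrable _ _)]
  have := h 0
  rw [zero_add] at this
  rw [this, sub_self]

theorem corr_deriv_zero (hp : IsSupport p) : corr p (deriv p) 0 = 0 := by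
  have h1 := hp.continuous
  have h2 := hp.continuous_deriv
  have := integral_deriv_eq_zero (f := fun x => p x ^ 2 / 2) (f' := fun x => p x * deriv p x)
    (fun x => by
      convert! ((hp.hasDerivAt x).pow 2).div_const 2 using 1
      push_cast; ring) (by fun_prop)
    (fun x => by simp only [hp.periodic x])
  simpa [corr] using this

/-- The expanded product equals terms in p(φ)p(φ+τ), its two τ-derivatives and squares, up to the
φ-derivative of a periodic function, which integrates to 0. -/
theorem integral_mul_gap (hp : IsSupport p) (τ : ℝ) :
    ∫ φ in (0 : ℝ)..2 * π, leadGap p φ τ * trailGap p φ τ =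
      (1 + cos τ ^ 2) * corr p p τ - 2 * cos τ * (∫ φ in (0 : ℝ)..2 * π, p φ ^ 2)
        - 2 * cos τ * sin τ * corr p (deriv p) τ + sin τ ^ 2 * corr p (deriv (deriv p)) τ := by
  have h1 := hp.continuous
  have h2 := hp.continuous_deriv
  have h3 := hp.continuous_deriv2
  set s := sin τ
  set c := cos τ
  have hz := integral_deriv_eq_zero
    (f := fun x => s * (p (x + τ) ^ 2 - p x ^ 2) / 2 + s * c * (p x * p (x + τ))
      - s ^ 2 * (p x * deriv p (x + τ)))
    (f' := fun x => s * (p (x + τ) * deriv p (x + τ) - p x * deriv p x) + s * c *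
      (deriv p x * p (x + τ) + p x * deriv p (x + τ)) -
      s ^ 2 * (deriv p x * deriv p (x + τ) + p x * deriv (deriv p) (x + τ)))
    (fun x => by
      have hs := (hp.hasDerivAt (x + τ)).comp_add_const x τ
      have hs' := (hp.hasDerivAt_deriv (x + τ)).comp_add_const x τ
      convert! ((((hs.pow 2).sub ((hp.hasDerivAt x).pow 2)).const_mul s).div_const 2).add
        (((hp.hasDerivAt x).mul hs).const_mul (s * c)) |>.sub
        (((hp.hasDerivAt x).mul hs').const_mul (s ^ 2)) using 1
      push_cast; ring) (by fun_prop)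
    (fun x => by simp only [add_right_comm x (2 * π) τ, hp.periodic _, hp.periodic_deriv _])
  have hq : ∫ φ in (0 : ℝ)..2 * π, p (φ + τ) ^ 2 = ∫ φ in (0 : ℝ)..2 * π, p φ ^ 2 :=
    integral_shift (u := fun φ => p φ ^ 2) (fun x => by simp only [hp.periodic x]) τ
  have hpt : ∀ φ, leadGap p φ τ * trailGap p φ τ =
      ((1 + c ^ 2) * (p φ * p (φ + τ)) - c * p φ ^ 2 - c * p (φ + τ) ^ 2
        - 2 * c * s * (p φ * deriv p (φ + τ)) + s ^ 2 * (p φ * deriv (deriv p) (φ + τ))) +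
      (s * (p (φ + τ) * deriv p (φ + τ) - p φ * deriv p φ) + s * c *
      (deriv p φ * p (φ + τ) + p φ * deriv p (φ + τ)) -
      s ^ 2 * (deriv p φ * deriv p (φ + τ) + p φ * deriv (deriv p) (φ + τ))) := fun φ => by
    simp only [leadGap, trailGap]
    ring
  simp only [hpt, corr]
  rw [intervalIntegral.integral_add (Continuous.intervalIntegrable (by fun_prop) _ _)
    (Continuous.intervalIntegrable (by fun_prop) _ _), hz,
    intervalIntegral.integral_add (Continuous.intervalIntegrable (by fun_prop) _ _)
    (Continuous.intervalIntegrable (by fun_prop) _ _),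
    intervalIntegral.integral_sub (Continuous.intervalIntegrable (by fun_prop) _ _)
    (Continuous.intervalIntegrable (by fun_prop) _ _),
    intervalIntegral.integral_sub (Continuous.intervalIntegrable (by fun_prop) _ _)
    (Continuous.intervalIntegrable (by fun_prop) _ _),
    intervalIntegral.integral_sub (Continuous.intervalIntegrable (by fun_prop) _ _)
    (Continuous.intervalIntegrable (by fun_prop) _ _)]
  simp only [intervalIntegral.integral_const_mul]
  rw [hq]
  ring

theorem integral_leadGap_sq (hp : IsSupport p) (τ : ℝ) :
    ∫ φ in (0 : ℝ)..2 * π, leadGap p φ τ ^ 2 =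
      (1 + cos τ ^ 2) * (∫ φ in (0 : ℝ)..2 * π, p φ ^ 2)
        + sin τ ^ 2 * (∫ φ in (0 : ℝ)..2 * π, deriv p φ ^ 2)
        - 2 * cos τ * corr p p τ + 2 * sin τ * corr p (deriv p) τ := by
  have h1 := hp.continuous
  have h2 := hp.continuous_deriv
  set s := sin τ
  set c := cos τ
  have hz := integral_deriv_eq_zero
    (f := fun x => s * c * p x ^ 2 - 2 * s * (p x * p (x + τ)))
    (f' := fun x => 2 * s * c * (p x * deriv p x) - 2 * s *
      (deriv p x * p (x + τ) + p x * deriv p (x + τ)))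
    (fun x => by
      have hs := (hp.hasDerivAt (x + τ)).comp_add_const x τ
      convert! (((hp.hasDerivAt x).pow 2).const_mul (s * c)).sub
        (((hp.hasDerivAt x).mul hs).const_mul (2 * s)) using 1
      push_cast; ring) (by fun_prop)
    (fun x => by simp only [add_right_comm x (2 * π) τ, hp.periodic _])
  have hq : ∫ φ in (0 : ℝ)..2 * π, p (φ + τ) ^ 2 = ∫ φ in (0 : ℝ)..2 * π, p φ ^ 2 :=
    integral_shift (u := fun φ => p φ ^ 2) (fun x => by simp only [hp.periodic x]) τ
  have hpt : ∀ φ, leadGap p φ τ ^ 2 =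
      (p (φ + τ) ^ 2 + c ^ 2 * p φ ^ 2 + s ^ 2 * deriv p φ ^ 2 - 2 * c * (p φ * p (φ + τ))
        + 2 * s * (p φ * deriv p (φ + τ))) +
      (2 * s * c * (p φ * deriv p φ) - 2 * s *
      (deriv p φ * p (φ + τ) + p φ * deriv p (φ + τ))) := fun φ => by
    simp only [leadGap]
    ring
  simp only [hpt, corr]
  rw [intervalIntegral.integral_add (Continuous.intervalIntegrable (by fun_prop) _ _)
    (Continuous.intervalIntegrable (by fun_prop) _ _), hz,
    intervalIntegral.integral_add (Continuous.intervalIntegrable (by fun_prop) _ _)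
    (Continuous.intervalIntegrable (by fun_prop) _ _),
    intervalIntegral.integral_sub (Continuous.intervalIntegrable (by fun_prop) _ _)
    (Continuous.intervalIntegrable (by fun_prop) _ _),
    intervalIntegral.integral_add (Continuous.intervalIntegrable (by fun_prop) _ _)
    (Continuous.intervalIntegrable (by fun_prop) _ _),
    intervalIntegral.integral_add (Continuous.intervalIntegrable (by fun_prop) _ _)
    (Continuous.intervalIntegrable (by fun_prop) _ _)]
  simp only [intervalIntegral.integral_const_mul]
  rw [hq]
  ring

/-- For an even periodic weight, half a period of an autocorrelation gives half the double
integral. -/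
theorem integral_corr_mul_half (hp : IsSupport p) {w : ℝ → ℝ} (hw : Continuous w)
    (hwp : Function.Periodic w (2 * π)) (hwe : ∀ x, w (-x) = w x) :
    ∫ τ in (0 : ℝ)..π, corr p p τ * w τ =
      (1 / 2) * ∫ φ in (0 : ℝ)..2 * π, p φ * ∫ ψ in (0 : ℝ)..2 * π, p ψ * w (ψ - φ) := by
  have hc := continuous_corr hp.continuous hp.continuous
  rw [← integral_corr_mul hp.continuous hp.continuous hw hp.periodic hwp,
    ← integral_add_adjacent_intervals (a := 0) (b := π) (c := 2 * π)
      (Continuous.intervalIntegrable (by fun_prop) _ _)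
      (Continuous.intervalIntegrable (by fun_prop) _ _)]
  -- The reflection τ ↦ 2π - τ preserves both factors, so the two half periods contribute equally.
  have : ∫ τ in π..2 * π, corr p p τ * w τ = ∫ τ in (0 : ℝ)..π, corr p p τ * w τ := by
    have h := integral_comp_sub_left (a := (0 : ℝ)) (b := π) (fun τ => corr p p τ * w τ) (2 * π)
    rw [show 2 * π - π = π by ring, sub_zero] at h
    rw [← h]
    refine integral_congr fun τ _ => ?_
    have h1 : corr p p (2 * π - τ) = corr p p τ := by
      rw [sub_eq_neg_add, corr_add_two_pi hp.periodic, corr_neg hp.periodic hp.periodic]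
    have h2 : w (2 * π - τ) = w τ := by rw [sub_eq_neg_add, hwp, hwe]
    simp only [h1, h2]
  rw [this]
  ring

theorem integral_corr_half (hp : IsSupport p) :
    ∫ τ in (0 : ℝ)..π, corr p p τ = (1 / 2) * (∫ φ in (0 : ℝ)..2 * π, p φ) ^ 2 := by
  have := hp.integral_corr_mul_half (w := fun _ => 1) continuous_const (fun _ => rfl) fun _ => rfl
  simp only [mul_one, intervalIntegral.integral_mul_const] at this
  rw [this]
  ring

theorem integral_corr_cos_half (hp : IsSupport p) :
    ∫ τ in (0 : ℝ)..π, corr p p τ * cos (2 * τ) =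
      (1 / 2) * ((∫ φ in (0 : ℝ)..2 * π, p φ * cos (2 * φ)) ^ 2 +
        (∫ φ in (0 : ℝ)..2 * π, p φ * sin (2 * φ)) ^ 2) := by
  have h1 := hp.continuous
  rw [hp.integral_corr_mul_half (w := fun τ => cos (2 * τ)) (by fun_prop)
    (fun τ => by
      simp only [mul_add]
      rw [show 2 * (2 * π) = ((2 : ℕ) : ℝ) * (2 * π) by norm_num, cos_add_nat_mul_two_pi])
    (fun τ => by simp)]
  have h2 : ∀ φ, ∫ ψ in (0 : ℝ)..2 * π, p ψ * cos (2 * (ψ - φ)) =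
      cos (2 * φ) * (∫ ψ in (0 : ℝ)..2 * π, p ψ * cos (2 * ψ)) +
        sin (2 * φ) * ∫ ψ in (0 : ℝ)..2 * π, p ψ * sin (2 * ψ) := fun φ => by
    rw [← intervalIntegral.integral_const_mul, ← intervalIntegral.integral_const_mul,
      ← intervalIntegral.integral_add (Continuous.intervalIntegrable (by fun_prop) _ _)
      (Continuous.intervalIntegrable (by fun_prop) _ _)]
    refine integral_congr fun ψ _ => ?_
    simp only [mul_sub, cos_sub]
    ring
  simp only [h2, mul_add, ← mul_assoc]
  rw [intervalIntegral.integral_add (Continuous.intervalIntegrable (by fun_prop) _ _)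
      (Continuous.intervalIntegrable (by fun_prop) _ _), intervalIntegral.integral_mul_const,
      intervalIntegral.integral_mul_const]
  ring

end IsSupport

/-! ### Integrability and the formulas of Hurwitz and Crofton. -/

theorem sub_sin_mem_Icc {x : ℝ} (hx : 0 ≤ x) : x - sin x ∈ Icc 0 (x ^ 3) := by
  rcases hx.eq_or_lt with rfl | h
  · simp
  · have h1 := sin_gt_sub_cube h
    have h2 := sin_lt h
    have h3 : 0 < x ^ 3 := by positivity
    exact ⟨by linarith, by linarith⟩

namespace IsSupport

variable {p : ℝ → ℝ}

/-- The gap bounds reduce the density to a constant times (1 - cos τ)²/sin³τ = sin(τ/2)/(2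
cos³(τ/2)), and Jordan's inequality gives cos(τ/2) ≥ (π - τ)/π. Far from `K` the density may grow
like ω⁻³, which a weight of size ω³ compensates. -/
theorem exists_exteriorDensity_le (hp : IsSupport p) : ∃ C, ∀ φ, ∀ τ ∈ Ioo 0 π,
    0 ≤ exteriorDensity p (φ, τ) ∧ exteriorDensity p (φ, τ) * (π - τ) ^ 3 ≤ C := by
  obtain ⟨C, hC, hle⟩ := hp.exists_gap_le
  refine ⟨C ^ 2 * π ^ 3 / 2, fun φ τ hτ => ?_⟩
  have ha := hp.leadGap_pos φ hτ.1 hτ.2.le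
  have hb := hp.trailGap_pos φ hτ.1 hτ.2.le
  have hs := sin_pos_of_mem_Ioo hτ
  obtain ⟨ha', hb'⟩ := hle φ τ hτ.1.le hτ.2.le
  simp only [exteriorDensity]
  refine ⟨by positivity, ?_⟩
  have hx0 : 0 < sin (τ / 2) := sin_pos_of_pos_of_lt_pi (by linarith [hτ.1])
    (by linarith [hτ.2, hτ.1])
  have hx1 : sin (τ / 2) ≤ 1 := sin_le_one _
  have hy : (π - τ) / π ≤ cos (τ / 2) := by
    have := mul_le_sin (x := (π - τ) / 2) (by linarith [hτ.2]) (by linarith [hτ.1])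
    rw [show (π - τ) / 2 = π / 2 - τ / 2 by ring, sin_pi_div_two_sub] at this
    refine le_trans (le_of_eq ?_) this
    field_simp
  have hω : 0 < π - τ := by linarith [hτ.2]
  have hy0 : 0 < cos (τ / 2) := lt_of_lt_of_le (by positivity) hy
  have hsin : sin τ = 2 * sin (τ / 2) * cos (τ / 2) := by
    rw [← sin_two_mul]; congr 1; ring
  have hcos : 1 - cos τ = 2 * sin (τ / 2) ^ 2 := by
    have := cos_two_mul (τ / 2)
    rw [show 2 * (τ / 2) = τ by ring] at this
    rw [this, cos_sq']
    ring
  have h1 : leadGap p φ τ * trailGap p φ τ ≤ (C * (1 - cos τ)) * (C * (1 - cos τ)) :=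
    mul_le_mul ha' hb' hb.le (ha.le.trans ha')
  have h2 : π - τ ≤ π * cos (τ / 2) := by
    rw [div_le_iff₀ pi_pos] at hy
    linarith
  have h3 : 0 ≤ C * (1 - cos τ) := ha.le.trans ha'
  calc leadGap p φ τ * trailGap p φ τ / sin τ ^ 3 * (π - τ) ^ 3
      ≤ (C * (1 - cos τ)) * (C * (1 - cos τ)) / sin τ ^ 3 * (π * cos (τ / 2)) ^ 3 := by
        gcongr
    _ = C ^ 2 * π ^ 3 / 2 * sin (τ / 2) := by
        rw [hsin, hcos]
        field_simp
    _ ≤ C ^ 2 * π ^ 3 / 2 * 1 := by gcongr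
    _ = _ := mul_one _

theorem integrableOn_exteriorDensity_mul (hp : IsSupport p) {g : ℝ → ℝ} (hg : Continuous g)
    (hg' : ∀ ω ∈ Ioo 0 π, |g ω| ≤ ω ^ 3) :
    IntegrableOn (fun q => exteriorDensity p q * g (π - q.2)) (Ico 0 (2 * π) ×ˢ Ioo 0 π) := by
  obtain ⟨C, hC⟩ := hp.exists_exteriorDensity_le
  have hmeas : MeasurableSet (Ico (0 : ℝ) (2 * π) ×ˢ Ioo (0 : ℝ) π) :=
    measurableSet_Ico.prod measurableSet_Ioo
  have h0 := hp.continuous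
  have h1 := hp.continuous_deriv
  refine IntegrableOn.of_bound ?_ (ContinuousOn.aestronglyMeasurable ?_ hmeas) C ?_
  · rw [Measure.volume_eq_prod, Measure.prod_prod, volume_Ico, volume_Ioo]
    exact ENNReal.mul_lt_top ENNReal.ofReal_lt_top ENNReal.ofReal_lt_top
  · unfold exteriorDensity leadGap trailGap
    refine ContinuousOn.mul (ContinuousOn.div (by fun_prop) (by fun_prop) fun q hq => ?_)
      (by fun_prop)
    exact pow_ne_zero _ (sin_pos_of_mem_Ioo hq.2).ne'
  · refine (ae_restrict_iff' hmeas).2 (Eventually.of_forall fun q hq => ?_)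
    obtain ⟨h2, h3⟩ := hC q.1 q.2 hq.2
    rw [norm_mul, Real.norm_eq_abs, Real.norm_eq_abs, abs_of_nonneg h2]
    refine le_trans (mul_le_mul_of_nonneg_left (hg' _ ⟨?_, ?_⟩) h2) h3
    · linarith [hq.2.2]
    · linarith [hq.2.1]

theorem integral_exteriorDensity_mul (hp : IsSupport p) {g : ℝ → ℝ} (hg : Continuous g)
    (hg' : ∀ ω ∈ Ioo 0 π, |g ω| ≤ ω ^ 3) :
    IntervalIntegrable (fun τ => (∫ φ in (0 : ℝ)..2 * π, leadGap p φ τ * trailGap p φ τ) /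
      sin τ ^ 3 * g (π - τ)) volume 0 π ∧
    ∫ q in Ico (0 : ℝ) (2 * π) ×ˢ Ioo (0 : ℝ) π, exteriorDensity p q * g (π - q.2) =
      ∫ τ in (0 : ℝ)..π, (∫ φ in (0 : ℝ)..2 * π, leadGap p φ τ * trailGap p φ τ) /
        sin τ ^ 3 * g (π - τ) := by
  have hint := hp.integrableOn_exteriorDensity_mul hg hg'
  rw [IntegrableOn, Measure.volume_eq_prod, ← Measure.prod_restrict] at hint
  have hin : ∀ τ, ∫ φ in Ico 0 (2 * π), exteriorDensity p (φ, τ) * g (π - τ) =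
      (∫ φ in (0 : ℝ)..2 * π, leadGap p φ τ * trailGap p φ τ) / sin τ ^ 3 * g (π - τ) := by
    intro τ
    rw [integral_Ico_eq_integral_Ioc, ← integral_of_le two_pi_pos.le,
      intervalIntegral.integral_mul_const]
    simp only [exteriorDensity, intervalIntegral.integral_div]
  constructor
  · rw [intervalIntegrable_iff_integrableOn_Ioo_of_le pi_pos.le]
    have := hint.integral_prod_right
    simp only [hin] at this
    exact this
  · rw [Measure.volume_eq_prod, ← Measure.prod_restrict, integral_prod_symm _ hint]
    simp only [hin]
    rw [integral_of_le pi_pos.le, integral_Ioc_eq_integral_Ioo]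

/-- Hurwitz's integral of `sin³ ω`. -/
theorem integral_mul_gap_sin (hp : IsSupport p) :
    ∫ τ in (0 : ℝ)..π, (∫ φ in (0 : ℝ)..2 * π, leadGap p φ τ * trailGap p φ τ) /
        sin τ ^ 3 * sin (π - τ) ^ 3 =
      3 / 4 * (∫ φ in (0 : ℝ)..2 * π, p φ) ^ 2 + 9 / 4 *
        ((∫ φ in (0 : ℝ)..2 * π, p φ * cos (2 * φ)) ^ 2 +
          (∫ φ in (0 : ℝ)..2 * π, p φ * sin (2 * φ)) ^ 2) := by
  set a := ∫ φ in (0 : ℝ)..2 * π, p φ ^ 2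
  have hc := continuous_corr hp.continuous hp.continuous
  have hc1 := continuous_corr hp.continuous hp.continuous_deriv
  have hc2 := continuous_corr hp.continuous hp.continuous_deriv2
  -- Apart from the exact derivative verified below, the coefficient of R is 1 + cos²τ + 4 cos 2τ =
  -- 3/2 + (9/2) cos 2τ. This leaves only the mean and the second harmonic of p.
  have h1 : ∫ τ in (0 : ℝ)..π, (∫ φ in (0 : ℝ)..2 * π, leadGap p φ τ * trailGap p φ τ) /
        sin τ ^ 3 * sin (π - τ) ^ 3 =
      ∫ τ in (0 : ℝ)..π, ((3 / 2 * corr p p τ + 9 / 2 * (corr p p τ * cos (2 * τ))) +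
        (sin τ ^ 2 * corr p (deriv (deriv p)) τ - 2 * sin τ * cos τ * corr p (deriv p) τ
          - 4 * cos (2 * τ) * corr p p τ - 2 * a * cos τ)) := by
    rw [integral_of_le pi_pos.le, integral_of_le pi_pos.le, integral_Ioc_eq_integral_Ioo,
      integral_Ioc_eq_integral_Ioo]
    refine setIntegral_congr_fun measurableSet_Ioo fun τ hτ => ?_
    have hs := sin_pos_of_mem_Ioo hτ
    rw [sin_pi_sub, div_mul_cancel₀ _ (by positivity), hp.integral_mul_gap, cos_two_mul]
    ring
  have hd : ∀ τ ∈ uIcc 0 π, HasDerivAt (fun τ => sin τ ^ 2 * corr p (deriv p) τ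
        - 2 * (sin (2 * τ) * corr p p τ) - 2 * a * sin τ)
      (sin τ ^ 2 * corr p (deriv (deriv p)) τ - 2 * sin τ * cos τ * corr p (deriv p) τ
          - 4 * cos (2 * τ) * corr p p τ - 2 * a * cos τ) τ := fun τ _ => by
    have h2 : HasDerivAt (fun τ => sin (2 * τ)) (cos (2 * τ) * 2) τ := by
      simpa using ((hasDerivAt_id τ).const_mul 2).sin
    convert! (((hasDerivAt_sin τ).pow 2).mul (hp.hasDerivAt_corr_deriv τ)).sub
      ((h2.mul (hp.hasDerivAt_corr_self τ)).const_mul 2) |>.sub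
      ((hasDerivAt_sin τ).const_mul (2 * a)) using 1
    rw [sin_two_mul]
    simp
    ring
  rw [h1, intervalIntegral.integral_add (Continuous.intervalIntegrable (by fun_prop) _ _)
    (Continuous.intervalIntegrable (by fun_prop) _ _), integral_eq_sub_of_hasDerivAt hd
    (Continuous.intervalIntegrable (by fun_prop) _ _),
    intervalIntegral.integral_add (Continuous.intervalIntegrable (by fun_prop) _ _)
    (Continuous.intervalIntegrable (by fun_prop) _ _), intervalIntegral.integral_const_mul,
    intervalIntegral.integral_const_mul, hp.integral_corr_half, hp.integral_corr_cos_half]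
  simp
  ring

/-- The antiderivative arising in the proof of Crofton's formula. -/
def croftonAux (p : ℝ → ℝ) (τ : ℝ) : ℝ :=
  (1 / 2) * (∫ φ in (0 : ℝ)..2 * π, leadGap p φ τ ^ 2) *
    ((π - τ - sin τ) / sin τ ^ 2 - sin τ / (1 - cos τ))

/-- With J the integral of the squared leading gap, J/(2 sin²τ) is an antiderivative of the
φ-integrated density. Integrating by parts leaves the term -J/(2(1 - cos τ)), which the derivative
of sin τ/(1 - cos τ) absorbs. The remainder is -(1 + cos τ) J'/(2 sin τ), and J' is divisible by sin
τ. -/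
theorem hasDerivAt_croftonAux (hp : IsSupport p) {τ : ℝ} (hτ : τ ∈ Ioo 0 π) :
    HasDerivAt (croftonAux p)
      ((∫ φ in (0 : ℝ)..2 * π, leadGap p φ τ * trailGap p φ τ) / sin τ ^ 3 * (π - τ - sin τ) -
        (1 + cos τ) * (cos τ * ((∫ φ in (0 : ℝ)..2 * π, deriv p φ ^ 2) -
          ∫ φ in (0 : ℝ)..2 * π, p φ ^ 2) + corr p p τ + corr p (deriv (deriv p)) τ)) τ := by
  have hs := (sin_pos_of_mem_Ioo hτ).ne'
  have hsc := sin_sq_add_cos_sq τ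
  have hc : 1 - cos τ ≠ 0 := fun h => by
    have h' : cos τ = 1 := by linarith
    rw [h'] at hsc
    exact hs (pow_eq_zero_iff two_ne_zero |>.1 (by linarith))
  have heq : croftonAux p = fun τ => (1 / 2) * ((1 + cos τ ^ 2) * (∫ φ in (0 : ℝ)..2 * π, p φ ^ 2)
        + sin τ ^ 2 * (∫ φ in (0 : ℝ)..2 * π, deriv p φ ^ 2)
        - 2 * cos τ * corr p p τ + 2 * sin τ * corr p (deriv p) τ) *
    ((π - τ - sin τ) / sin τ ^ 2 - sin τ / (1 - cos τ)) := by
    ext τ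
    rw [croftonAux, hp.integral_leadGap_sq]
  rw [heq, hp.integral_mul_gap]
  set a := ∫ φ in (0 : ℝ)..2 * π, p φ ^ 2
  set b := ∫ φ in (0 : ℝ)..2 * π, deriv p φ ^ 2
  have dS := hasDerivAt_sin τ
  have dC := hasDerivAt_cos τ
  have hJ := ((((((dC.pow 2).const_add 1).mul_const a).add ((dS.pow 2).mul_const b)).sub
    ((dC.const_mul 2).mul (hp.hasDerivAt_corr_self τ))).add
    ((dS.const_mul 2).mul (hp.hasDerivAt_corr_deriv τ))).const_mul (1 / 2)
  have hL : HasDerivAt (fun τ => π - τ - sin τ) (-1 - cos τ) τ :=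
    ((hasDerivAt_id τ).const_sub π).sub dS
  have hB := (hL.div (dS.pow 2) (pow_ne_zero 2 hs)).sub (dS.div (dC.const_sub 1) hc)
  convert! hJ.mul hB using 1
  simp only [Pi.pow_apply, Pi.mul_apply, Pi.sub_apply, Pi.add_apply, Pi.div_apply, Nat.cast_ofNat,
    Nat.add_one_sub_one, pow_one]
  generalize sin τ = s at *
  generalize cos τ = c at *
  generalize corr p p τ = R at *
  generalize corr p (deriv p) τ = R1 at *
  generalize corr p (deriv (deriv p)) τ = R2 at *
  generalize π - τ - s = w at *
  have e1 : s / (1 - c) = (1 + c) / s := by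
    rw [div_eq_div_iff hc hs]
    linear_combination hsc
  have e2 : (c * (1 - c) - s * - -s) / (1 - c) ^ 2 = -(1 + c) / s ^ 2 := by
    rw [div_eq_div_iff (pow_ne_zero 2 hc) (pow_ne_zero 2 hs)]
    linear_combination (c - 1 - s ^ 2) * hsc
  have e3 : (1 + c ^ 2) * R - 2 * c * a - 2 * c * s * R1 + s ^ 2 * R2 =
      s ^ 2 * ((b - a) * c + R + R2) -
        c * ((1 + c ^ 2) * a + s ^ 2 * b - 2 * c * R + 2 * s * R1) := by
    linear_combination (c * a - R) * hsc
  rw [e1, e2, e3]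
  field_simp
  ring

/-- Crofton's formula in terms of the support function. -/
theorem integral_mul_gap_crofton (hp : IsSupport p) :
    ∫ τ in (0 : ℝ)..π, (∫ φ in (0 : ℝ)..2 * π, leadGap p φ τ * trailGap p φ τ) /
        sin τ ^ 3 * (π - τ - sin (π - τ)) =
      1 / 2 * (∫ φ in (0 : ℝ)..2 * π, p φ) ^ 2 -
        π / 2 * ∫ φ in (0 : ℝ)..2 * π, (p φ ^ 2 - deriv p φ ^ 2) := by
  have h0 := hp.continuous
  have h1 := hp.continuous_deriv
  have hc := continuous_corr hp.continuous hp.continuous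
  have hc1 := continuous_corr hp.continuous hp.continuous_deriv
  have hc2 := continuous_corr hp.continuous hp.continuous_deriv2
  have hI := (hp.integral_exteriorDensity_mul (g := fun ω => ω - sin ω) (by fun_prop)
    fun ω hω => by
      have := sub_sin_mem_Icc hω.1.le
      rw [abs_of_nonneg this.1]
      exact this.2).1
  simp only [sin_pi_sub] at hI ⊢
  rw [intervalIntegral.integral_sub (Continuous.intervalIntegrable (by fun_prop) _ _)
    (Continuous.intervalIntegrable (by fun_prop) _ _)]
  set a := ∫ φ in (0 : ℝ)..2 * π, p φ ^ 2
  set b := ∫ φ in (0 : ℝ)..2 * π, deriv p φ ^ 2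
  set G := fun τ => (1 + cos τ) * (cos τ * (b - a) + corr p p τ + corr p (deriv (deriv p)) τ)
    with hG
  have hGc : Continuous G := by fun_prop
  have hGi : ∫ τ in (0 : ℝ)..π, G τ =
      1 / 2 * (∫ φ in (0 : ℝ)..2 * π, p φ) ^ 2 + π / 2 * (b - a) := by
    -- Subtracting R makes the R-terms of G the derivative of (1 + cos τ) R' + sin τ R. Its boundary
    -- values vanish: 1 + cos π = 0, and R'(0) = 0.
    have hd : ∀ τ ∈ uIcc 0 π, HasDerivAt (fun τ => (b - a) * (sin τ + τ / 2 + sin τ * cos τ / 2) +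
        ((1 + cos τ) * corr p (deriv p) τ + sin τ * corr p p τ)) (G τ - corr p p τ) τ := by
      intro τ _
      have dS := hasDerivAt_sin τ
      have dC := hasDerivAt_cos τ
      convert! (((dS.add ((hasDerivAt_id τ).div_const 2)).add
        ((dS.mul dC).div_const 2)).const_mul (b - a)).add
        (((dC.const_add 1).mul (hp.hasDerivAt_corr_deriv τ)).add
          (dS.mul (hp.hasDerivAt_corr_self τ))) using 1
      simp only [hG]
      linear_combination (b - a) / 2 * (sin_sq_add_cos_sq τ)
    have h2 := integral_eq_sub_of_hasDerivAt hd (Continuous.intervalIntegrable (by fun_prop) _ _)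
    rw [intervalIntegral.integral_sub (Continuous.intervalIntegrable (by fun_prop) _ _)
      (Continuous.intervalIntegrable (by fun_prop) _ _), hp.integral_corr_half,
      hp.corr_deriv_zero] at h2
    simp at h2
    linarith
  obtain ⟨C, hC, hle⟩ := hp.exists_gap_le
  have hJ : ∀ τ ∈ Ioo 0 π, 0 ≤ ∫ φ in (0 : ℝ)..2 * π, leadGap p φ τ ^ 2 ∧
      ∫ φ in (0 : ℝ)..2 * π, leadGap p φ τ ^ 2 ≤ 2 * π * C ^ 2 * (1 - cos τ) ^ 2 := by
    intro τ hτ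
    refine ⟨intervalIntegral.integral_nonneg two_pi_pos.le fun φ _ => sq_nonneg _, ?_⟩
    have hm := integral_mono_on (μ := volume) (f := fun φ => leadGap p φ τ ^ 2)
      (g := fun _ => (C * (1 - cos τ)) ^ 2) two_pi_pos.le
      (Continuous.intervalIntegrable (by unfold leadGap; fun_prop) _ _)
      (Continuous.intervalIntegrable (by fun_prop) _ _) fun φ _ =>
        pow_le_pow_left₀ (hp.leadGap_pos φ hτ.1 hτ.2.le).le (hle φ τ hτ.1.le hτ.2.le).1 2
    rw [intervalIntegral.integral_const, smul_eq_mul] at hm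
    linarith
  set V := fun τ => π * C ^ 2 * ((1 - cos τ) * ((π - τ) * (π ^ 2 / 2)) + (1 - cos τ) * sin τ)
    with hV
  have hVc : Continuous V := by fun_prop
  -- J is of order (1 - cos τ)², which cancels the singularity at 0; the cubic bound on ω - sin ω
  -- handles τ = π. The majorant V is continuous and zero at both ends, so no boundary term
  -- survives.
  have hbound : ∀ τ ∈ Ioo 0 π, |croftonAux p τ| ≤ V τ := by
    intro τ hτ
    obtain ⟨hJ0, hJ1⟩ := hJ τ hτ
    have hs := sin_pos_of_mem_Ioo hτ
    have hsc := sin_sq_add_cos_sq τ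
    have hω : 0 < π - τ := by linarith [hτ.2]
    have hcos := mul_le_sin (x := (π - τ) / 2) (by linarith) (by linarith [hτ.1])
    rw [show (π - τ) / 2 = π / 2 - τ / 2 by ring, sin_pi_div_two_sub] at hcos
    have hc1 : 1 + cos τ = 2 * cos (τ / 2) ^ 2 := by
      have := cos_two_mul (τ / 2)
      rw [show 2 * (τ / 2) = τ by ring] at this
      linarith
    have hc2 : (π - τ) ≤ π * cos (τ / 2) := by
      calc π - τ = π * (2 / π * (π / 2 - τ / 2)) := by field_simp
        _ ≤ _ := by gcongr
    have hc3 : (π - τ) ^ 2 * 2 ≤ π ^ 2 * (1 + cos τ) := by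
      have := pow_le_pow_left₀ hω.le hc2 2
      rw [hc1]
      linarith
    have hplus : 0 < 1 + cos τ := by
      have h : 0 < (π - τ) ^ 2 * 2 := by positivity
      exact pos_of_mul_pos_right (h.trans_le hc3) (by positivity)
    have hprod : (1 - cos τ) * (1 + cos τ) = sin τ ^ 2 := by linear_combination -hsc
    have hminus : 0 < 1 - cos τ :=
      pos_of_mul_pos_left (by rw [hprod]; positivity) hplus.le
    obtain ⟨hg0, hg1⟩ := sub_sin_mem_Icc hω.le
    rw [sin_pi_sub] at hg0 hg1
    have hq : (π - τ - sin τ) / (1 + cos τ) ≤ (π - τ) * (π ^ 2 / 2) := by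
      rw [div_le_iff₀ hplus]
      have := mul_le_mul_of_nonneg_left hc3 hω.le
      linarith
    have habs : |(π - τ - sin τ) / sin τ ^ 2 - sin τ / (1 - cos τ)| ≤
        (π - τ - sin τ) / sin τ ^ 2 + sin τ / (1 - cos τ) := by
      refine (abs_sub _ _).trans (le_of_eq ?_)
      rw [abs_of_nonneg (by positivity), abs_of_nonneg (by positivity)]
    rw [croftonAux, abs_mul, abs_of_nonneg (by positivity)]
    calc _ ≤ 1 / 2 * (2 * π * C ^ 2 * (1 - cos τ) ^ 2) *
          ((π - τ - sin τ) / sin τ ^ 2 + sin τ / (1 - cos τ)) := by gcongr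
      _ = π * C ^ 2 * ((1 - cos τ) * ((π - τ - sin τ) / (1 + cos τ)) + (1 - cos τ) * sin τ) := by
        rw [← hprod]
        field_simp
      _ ≤ _ := by
        simp only [hV]
        gcongr
  have h0lim : Tendsto (croftonAux p) (𝓝[>] 0) (𝓝 0) := by
    refine squeeze_zero_norm' (a := V) ?_ ?_
    · filter_upwards [Ioo_mem_nhdsGT pi_pos] with τ hτ using hbound τ hτ
    · have := (hVc.tendsto 0).mono_left (nhdsWithin_le_nhds (s := Ioi 0))
      simpa [hV] using this
  have hπlim : Tendsto (croftonAux p) (𝓝[<] π) (𝓝 0) := by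
    refine squeeze_zero_norm' (a := V) ?_ ?_
    · filter_upwards [Ioo_mem_nhdsLT pi_pos] with τ hτ using hbound τ hτ
    · have := (hVc.tendsto π).mono_left (nhdsWithin_le_nhds (s := Iio π))
      simpa [hV] using this
  have hfin := integral_eq_sub_of_hasDerivAt_of_tendsto pi_pos
    (fun τ hτ => hp.hasDerivAt_croftonAux hτ) (hI.sub (hGc.intervalIntegrable _ _)) h0lim hπlim
  rw [intervalIntegral.integral_sub hI (hGc.intervalIntegrable _ _), hGi] at hfin
  linarith

end IsSupport

/-! ### Fourier coefficients and the spectral inequality. -/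

/-- The squared modulus of the `n`-th Fourier coefficient on `[0, 2π]` of a real function. -/
def powerSpec (f : ℝ → ℝ) (n : ℤ) : ℝ :=
  ‖fourierCoeffOn two_pi_pos (fun x => (f x : ℂ)) n‖ ^ 2

theorem powerSpec_nonneg (f : ℝ → ℝ) (n : ℤ) : 0 ≤ powerSpec f n := sq_nonneg _

theorem hasSum_powerSpec {f : ℝ → ℝ} (hf : Continuous f) :
    HasSum (powerSpec f) ((2 * π)⁻¹ * ∫ x in (0 : ℝ)..2 * π, f x ^ 2) := by
  obtain ⟨C, hC⟩ := (isCompact_Icc (a := 0) (b := 2 * π)).exists_bound_of_continuousOn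
    hf.continuousOn
  have hL2 : MemLp (fun x => (f x : ℂ)) 2 (volume.restrict (Ioc 0 (2 * π))) := by
    refine MemLp.of_bound (Continuous.aestronglyMeasurable (by fun_prop)) C ?_
    refine (ae_restrict_iff' measurableSet_Ioc).2 (Eventually.of_forall fun x hx => ?_)
    rw [Complex.norm_real]
    exact hC x (Ioc_subset_Icc_self hx)
  have h := hasSum_sq_fourierCoeffOn two_pi_pos hL2
  simp only [Complex.norm_real, Real.norm_eq_abs, sq_abs, sub_zero, smul_eq_mul] at h
  exact h

theorem fourierCoeffOn_ofReal {f : ℝ → ℝ} (hf : Continuous f) (n : ℤ) :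
    fourierCoeffOn two_pi_pos (fun x => (f x : ℂ)) n =
      ((2 * π)⁻¹ : ℝ) * (((∫ x in (0 : ℝ)..2 * π, f x * cos (n * x) : ℝ) : ℂ) -
        (∫ x in (0 : ℝ)..2 * π, f x * sin (n * x) : ℝ) * Complex.I) := by
  rw [fourierCoeffOn_eq_integral, ← intervalIntegral.integral_ofReal,
    ← intervalIntegral.integral_ofReal, ← intervalIntegral.integral_mul_const,
    ← intervalIntegral.integral_sub (Continuous.intervalIntegrable (by fun_prop) _ _)
      (Continuous.intervalIntegrable (by fun_prop) _ _), Complex.real_smul]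
  congr 1
  · simp
  refine integral_congr fun x _ => ?_
  have hπ : (π : ℂ) ≠ 0 := by exact_mod_cast pi_ne_zero
  have he : (2 * π * Complex.I * ((-n : ℤ) : ℂ) * x / ((2 * π - 0 : ℝ) : ℂ)) =
      ((-(n * x) : ℝ) : ℂ) * Complex.I := by
    push_cast
    rw [sub_zero]
    field_simp
  simp only [fourier_coe_apply]
  rw [he, Complex.exp_mul_I, ← Complex.ofReal_cos, ← Complex.ofReal_sin, cos_neg, sin_neg,
    smul_eq_mul]
  push_cast
  ring

theorem powerSpec_eq {f : ℝ → ℝ} (hf : Continuous f) (n : ℤ) :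
    powerSpec f n = ((∫ x in (0 : ℝ)..2 * π, f x * cos (n * x)) ^ 2 +
      (∫ x in (0 : ℝ)..2 * π, f x * sin (n * x)) ^ 2) / (4 * π ^ 2) := by
  rw [powerSpec, fourierCoeffOn_ofReal hf, ← Complex.normSq_eq_norm_sq, Complex.normSq_mul,
    Complex.normSq_ofReal, Complex.normSq_apply]
  simp
  field_simp
  ring

theorem powerSpec_deriv {f f' : ℝ → ℝ} (hd : ∀ x, HasDerivAt f (f' x) x) (hf' : Continuous f')
    (hper : Function.Periodic f (2 * π)) (n : ℤ) : powerSpec f' n = n ^ 2 * powerSpec f n := by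
  rcases eq_or_ne n 0 with rfl | hn
  · rw [powerSpec_eq hf']
    simp [IsSupport.integral_deriv_eq_zero hd hf' hper]
  · have h := fourierCoeffOn_of_hasDerivAt two_pi_pos hn (f := fun x => (f x : ℂ))
      (f' := fun x => (f' x : ℂ)) (fun x _ => (hd x).ofReal_comp)
      (Continuous.intervalIntegrable (by fun_prop) _ _)
    have h0 := hper 0
    rw [zero_add] at h0
    simp only [h0, sub_self, mul_zero, zero_sub] at h
    have hn' : (n : ℝ) ≠ 0 := by exact_mod_cast hn
    rw [powerSpec, powerSpec, h]
    simp only [norm_mul, norm_div, norm_neg, Complex.norm_I, Complex.norm_intCast, norm_one,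
      Complex.norm_real, Real.norm_eq_abs, abs_of_pos pi_pos, Complex.ofReal_zero, sub_zero]
    simp
    have : |(n : ℝ)| ≠ 0 := abs_ne_zero.2 hn'
    field_simp
    rw [sq_abs]

namespace IsSupport

variable {p : ℝ → ℝ}

/-- Hurwitz's inequality in terms of the support function. -/
theorem hurwitz_inequality (hp : IsSupport p) {l a b e q V E : ℝ}
    (hl : l = ∫ φ in (0 : ℝ)..2 * π, p φ) (ha : a = ∫ φ in (0 : ℝ)..2 * π, p φ ^ 2)
    (hb : b = ∫ φ in (0 : ℝ)..2 * π, deriv p φ ^ 2)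
    (he : e = ∫ φ in (0 : ℝ)..2 * π, deriv (deriv p) φ ^ 2)
    (hq : q = (∫ φ in (0 : ℝ)..2 * π, p φ * cos (2 * φ)) ^ 2 +
          (∫ φ in (0 : ℝ)..2 * π, p φ * sin (2 * φ)) ^ 2)
    (hV : V = 5 / 4 * (l ^ 2 - 2 * π * (a - b)) - 15 / 2 * q)
    (hE : E = π / 2 * (e - b) - (l ^ 2 - 2 * π * (a - b))) :
    b ≤ e ∧ 0 ≤ V ∧ V ≤ E ∧ (V = 0 → E = 0) := by
  set x := powerSpec p with hx
  have hx0 : ∀ n, 0 ≤ x n := powerSpec_nonneg p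
  have sa : HasSum x ((2 * π)⁻¹ * a) := ha ▸ hasSum_powerSpec hp.continuous
  have sb : HasSum (fun n : ℤ => (n : ℝ) ^ 2 * x n) ((2 * π)⁻¹ * b) := by
    have h := hasSum_powerSpec hp.continuous_deriv
    rw [← hb] at h
    convert h using 2 with n
    rw [powerSpec_deriv hp.hasDerivAt hp.continuous_deriv hp.periodic]
  have se : HasSum (fun n : ℤ => (n : ℝ) ^ 4 * x n) ((2 * π)⁻¹ * e) := by
    have h := hasSum_powerSpec hp.continuous_deriv2
    rw [← he] at h
    convert h using 2 with n
    rw [powerSpec_deriv hp.hasDerivAt_deriv hp.continuous_deriv2 hp.periodic_deriv,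
      powerSpec_deriv hp.hasDerivAt hp.continuous_deriv hp.periodic]
    ring
  have x0 : x 0 = l ^ 2 / (4 * π ^ 2) := by
    rw [hx, powerSpec_eq hp.continuous, hl]
    simp
  have x2 : x 2 = q / (4 * π ^ 2) := by
    rw [hx, powerSpec_eq hp.continuous, hq]
    simp
  have x2' : x (-2) = q / (4 * π ^ 2) := by
    rw [hx, powerSpec_eq hp.continuous, hq]
    simp
  have hpt (n : ℤ) (c : ℝ) : HasSum (fun m : ℤ => if m = n then c else 0) c := hasSum_ite_eq n c
  -- Up to the factors 5π² and π², these two series are the visual bound and the deficit. The point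
  -- masses cancel n = 0 in both and n = ±2 in the first, where n² - 1 = 3.
  have sy := (((sb.sub sa).add (hpt 0 (x 0))).sub (hpt 2 (3 * x 2))).sub (hpt (-2) (3 * x (-2)))
  have sz := ((((se.sub (sb.mul_left 5)).add (sa.mul_left 4)).sub (hpt 0 (4 * x 0))))
  have key : ∀ n : ℤ, (0 ≤ (n : ℝ) ^ 2 * x n - x n + (if n = 0 then x 0 else 0) -
        (if n = 2 then 3 * x 2 else 0) - (if n = -2 then 3 * x (-2) else 0)) ∧
      5 * ((n : ℝ) ^ 2 * x n - x n + (if n = 0 then x 0 else 0) -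
        (if n = 2 then 3 * x 2 else 0) - (if n = -2 then 3 * x (-2) else 0)) ≤
      (n : ℝ) ^ 4 * x n - 5 * ((n : ℝ) ^ 2 * x n) + 4 * x n - (if n = 0 then 4 * x 0 else 0) ∧
      ((n : ℝ) ^ 2 * x n - x n + (if n = 0 then x 0 else 0) -
        (if n = 2 then 3 * x 2 else 0) - (if n = -2 then 3 * x (-2) else 0) = 0 →
      (n : ℝ) ^ 4 * x n - 5 * ((n : ℝ) ^ 2 * x n) + 4 * x n -
        (if n = 0 then 4 * x 0 else 0) = 0) := by
    intro n
    -- For |n| ≤ 2 both terms vanish: n² - 1 kills ±1, n² - 4 kills ±2 in the second series, and the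
    -- corrections remove the rest.
    by_cases hn : n = 0 ∨ n = 2 ∨ n = -2 ∨ n = 1 ∨ n = -1
    · rcases hn with rfl | rfl | rfl | rfl | rfl <;> norm_num <;> ring_nf <;> norm_num
    · push Not at hn
      obtain ⟨n0, n2, n2', n1, n1'⟩ := hn
      simp only [if_neg n0, if_neg n2, if_neg n2']
      have h9 : (9 : ℝ) ≤ (n : ℝ) ^ 2 := by
        have : 3 ≤ n ∨ n ≤ -3 := by omega
        have : 9 ≤ n ^ 2 := by rcases this with h | h <;> nlinarith
        exact_mod_cast this
      have hxn := hx0 n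
      refine ⟨?_, ?_, fun h => ?_⟩
      · nlinarith
      -- The difference of the two sides is (n² - 1)(n² - 9) x_n.
      · have := mul_nonneg (mul_nonneg (sub_nonneg.2 h9) (by linarith : 0 ≤ (n : ℝ) ^ 2 - 1)) hxn
        linarith
      · have : x n = 0 := by nlinarith
        simp [this]
  set y : ℤ → ℝ := fun n => (n : ℝ) ^ 2 * x n - x n + (if n = 0 then x 0 else 0) -
        (if n = 2 then 3 * x 2 else 0) - (if n = -2 then 3 * x (-2) else 0) with hy
  set z : ℤ → ℝ := fun n => (n : ℝ) ^ 4 * x n - 5 * ((n : ℝ) ^ 2 * x n) + 4 * x n -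
    (if n = 0 then 4 * x 0 else 0) with hz
  have eV : V = 5 * π ^ 2 * ((2 * π)⁻¹ * b - (2 * π)⁻¹ * a + x 0 - 3 * x 2 - 3 * x (-2)) := by
    rw [hV, x0, x2, x2']
    field_simp
    ring
  have eE : E = π ^ 2 * ((2 * π)⁻¹ * e - 5 * ((2 * π)⁻¹ * b) + 4 * ((2 * π)⁻¹ * a) - 4 * x 0) := by
    rw [hE, x0]
    field_simp
    ring
  have hπ : 0 < π ^ 2 := by positivity
  refine ⟨?_, ?_, ?_, fun h => ?_⟩
  · have h := hasSum_le (fun n : ℤ => ?_) sb se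
    · exact le_of_mul_le_mul_left h (by positivity)
    · rcases eq_or_ne n 0 with rfl | hn
      · simp
      · have h1 : (1 : ℝ) ≤ (n : ℝ) ^ 2 := by
          have : 0 < n ^ 2 := by positivity
          exact_mod_cast this
        have := mul_nonneg (mul_nonneg (sub_nonneg.2 h1) (sq_nonneg (n : ℝ))) (hx0 n)
        linarith
  · rw [eV]
    exact mul_nonneg (by positivity) (sy.nonneg fun n => (key n).1)
  · rw [eV, eE, mul_comm 5 (π ^ 2), mul_assoc]
    exact mul_le_mul_of_nonneg_left (hasSum_le (fun n => (key n).2.1) (sy.mul_left 5) sz) hπ.le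
  · rw [eV, mul_eq_zero, or_iff_right (by positivity)] at h
    rw [h] at sy
    have hy0 := (hasSum_zero_iff_of_nonneg fun n => (key n).1).1 sy
    have hz0 : ∀ n, z n = 0 := fun n => (key n).2.2 (congrFun hy0 n)
    have hsz : HasSum z 0 := by
      rw [funext hz0]
      exact hasSum_zero
    rw [eE, sz.unique hsz, mul_zero]

end IsSupport

/-! ### Assembling the integral, the evolute area and the theorem. -/

namespace IsStrictlyConvexC2

variable {K : Set Plane}

theorem angleIntegrand_integral (hK : IsStrictlyConvexC2 K) :
    IntegrableOn (angleIntegrand K) Kᶜ ∧ ∫ P in Kᶜ, angleIntegrand K P =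
      1 / 2 * length K ^ 2 - π * area K - 2 / 3 * (3 / 4 * length K ^ 2 + 9 / 4 *
        ((∫ φ in (0 : ℝ)..2 * π, supportFn K φ * cos (2 * φ)) ^ 2 +
          (∫ φ in (0 : ℝ)..2 * π, supportFn K φ * sin (2 * φ)) ^ 2)) := by
  have hp := hK.isSupport
  have b1 : ∀ ω ∈ Ioo 0 π, |ω - sin ω| ≤ ω ^ 3 := fun ω hω => by
    have := sub_sin_mem_Icc hω.1.le
    rw [abs_of_nonneg this.1]
    exact this.2
  have b2 : ∀ ω ∈ Ioo 0 π, |sin ω ^ 3| ≤ ω ^ 3 := fun ω hω => by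
    have hs := sin_pos_of_mem_Ioo hω
    rw [abs_of_pos (by positivity)]
    exact pow_le_pow_left₀ hs.le (sin_le hω.1.le) 3
  have c1 : Continuous fun ω => ω - sin ω := by fun_prop
  have c2 : Continuous fun ω => sin ω ^ 3 := by fun_prop
  obtain ⟨i1, e1⟩ := hK.integral_exterior fun ω => ω - sin ω
  obtain ⟨i2, e2⟩ := hK.integral_exterior fun ω => sin ω ^ 3
  have j1 := i1.2 (hp.integrableOn_exteriorDensity_mul c1 b1)
  have j2 := i2.2 (hp.integrableOn_exteriorDensity_mul c2 b2)
  rw [(hp.integral_exteriorDensity_mul c1 b1).2, hp.integral_mul_gap_crofton] at e1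
  rw [(hp.integral_exteriorDensity_mul c2 b2).2, hp.integral_mul_gap_sin] at e2
  have hfun : angleIntegrand K = fun P => (visualAngle K P - sin (visualAngle K P)) -
      2 / 3 * sin (visualAngle K P) ^ 3 := rfl
  rw [hfun]
  refine ⟨j1.sub (j2.const_mul _), ?_⟩
  rw [MeasureTheory.integral_sub j1 (j2.const_mul _), MeasureTheory.integral_const_mul, e1, e2,
    hK.length_eq, hK.area_eq]
  ring

theorem evoluteArea_eq (hK : IsStrictlyConvexC2 K) :
    evoluteArea K = 1 / 2 * ((∫ φ in (0 : ℝ)..2 * π, deriv (supportFn K) φ ^ 2) -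
      ∫ φ in (0 : ℝ)..2 * π, deriv (deriv (supportFn K)) φ ^ 2) := by
  have hp := hK.isSupport
  have h1 := hp.continuous_deriv
  have h2 := hp.continuous_deriv2
  have hev : evoluteSupport K = fun t => deriv (supportFn K) (t - π / 2) :=
    funext (evoluteSupport_eq K)
  rw [evoluteArea, multArea, hev]
  simp only [deriv_comp_sub_const]
  have := integral_shift (u := fun t => deriv (supportFn K) t ^ 2 -
    deriv (deriv (supportFn K)) t ^ 2)
    (fun t => by simp only [hp.periodic_deriv t, hp.periodic_deriv2 t]) (-(π / 2))
  simp only [← sub_eq_add_neg] at this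
  rw [this, intervalIntegral.integral_sub (Continuous.intervalIntegrable (by fun_prop) _ _)
    (Continuous.intervalIntegrable (by fun_prop) _ _)]

end IsStrictlyConvexC2

end Hurwitz

end

theorem mainTheorem1 (K : Set Hurwitz.Plane) (hK : Hurwitz.IsStrictlyConvexC2 K) :
    MeasureTheory.IntegrableOn (Hurwitz.angleIntegrand K) Kᶜ ∧
    Hurwitz.visualBound K ≤ Hurwitz.hurwitzDeficit K ∧
    (Hurwitz.hurwitzDeficit K ≠ 0 → 0 < Hurwitz.visualBound K) ∧
    (Hurwitz.hurwitzDeficit K = 0 → Hurwitz.visualBound K = 0) := by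
  have hp := hK.isSupport
  obtain ⟨hint, heq⟩ := hK.angleIntegrand_integral
  have harea := hK.area_eq
  have h0 := hp.continuous
  have h1 := hp.continuous_deriv
  rw [intervalIntegral.integral_sub (Continuous.intervalIntegrable (by fun_prop) _ _)
    (Continuous.intervalIntegrable (by fun_prop) _ _)] at harea
  obtain ⟨hbe, hnonneg, hle, hz⟩ := hp.hurwitz_inequality (V := Hurwitz.visualBound K)
    (E := π / 2 * ((∫ φ in (0 : ℝ)..2 * π, deriv (deriv (Hurwitz.supportFn K)) φ ^ 2) -
      ∫ φ in (0 : ℝ)..2 * π, deriv (Hurwitz.supportFn K) φ ^ 2) - Hurwitz.isoDeficit K)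
    hK.length_eq rfl rfl rfl rfl
    (by rw [Hurwitz.visualBound, heq, harea]; ring)
    (by rw [Hurwitz.isoDeficit, harea]; ring)
  have hdef : Hurwitz.hurwitzDeficit K =
      π / 2 * ((∫ φ in (0 : ℝ)..2 * π, deriv (deriv (Hurwitz.supportFn K)) φ ^ 2) -
      ∫ φ in (0 : ℝ)..2 * π, deriv (Hurwitz.supportFn K) φ ^ 2) - Hurwitz.isoDeficit K := by
    -- The evolute area is nonpositive because ∫ p'² ≤ ∫ p''², so the absolute value reverses its
    -- sign.
    rw [Hurwitz.hurwitzDeficit, hK.evoluteArea_eq, abs_of_nonpos (by linarith)]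
    ring
  rw [← hdef] at hle hz
  exact ⟨hint, hle, fun hne => lt_of_le_of_ne hnonneg fun h => hne (hz h.symm),
    fun h => le_antisymm (h ▸ hle) hnonneg⟩
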